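/- Let $D\ge 2$ be an integer and let $X$ be the power set of a $D$-element set. The $D$-dimensional hypercube $H(D,2)$ is the graph with vertex set $X$ in which $x,y\in X$ are adjacent if and only if one of them covers the other in the poset $(X,\subseteq)$. Let $R_2$ be the set of pairs $(x,y)\in X\times X$ at distance $2$ in $H(D,2)$. Let $\mathbb C^X$ be the complex vector space with basis $X$, and define linear maps $\mathbf A_2^J,\mathbf A_2^{\bar J},\mathbf A_2^*:\mathbb C^X\to\mathbb C^X$ by $$ \mathbf A_2^J x=\sum_{\substack{|y|=|x|\\ (x,y)\in R_2}} y,\qquad \mathbf A_2^{\bar J} x=\sum_{\substack{|y|\neq|x|\\ (x,y)\in R_2}} y,\qquad \mathbf A_2^* x=\frac{(D-2|x|)^2-D}{2}\,x\qquad(x\in X). $$ Let $\mathbf R$ be the unital subalgebra of $\mathrm{End}(\mathbb C^X)$ generated by $\mathbf A_2^J,\mathbf A_2^{\bar J},\mathbf A_2^*$. For an algebra $\mathcal A$ write $n\cdot\mathcal A$ for the direct sum of $n$ copies of $\mathcal A$; an empty direct sum is the zero algebra. Then: (i) The algebra $\mathbf R$ is isomorphic, as a unital $\mathbb C$-algebra,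 to $$ \begin{cases} \displaystyle\bigoplus_{k=1}^{\frac{D+1}{2}}\mathrm{End}(\mathbb C^k) & \text{if } D \text{ is odd},\\[2ex] \displaystyle 4\cdot\mathrm{End}\bigl(\mathbb C^{\frac{D+2}{4}}\bigr)\oplus 8\cdot\bigoplus_{k=1}^{\frac{D-2}{4}}\mathrm{End}(\mathbb C^k) & \text{if } D\equiv 2\pmod 4,\\[2ex] \displaystyle \mathrm{End}\bigl(\mathbb C^{\frac{D}{4}+1}\bigr)\oplus 7\cdot\mathrm{End}\bigl(\mathbb C^{\frac{D}{4}}\bigr)\oplus 8\cdot\bigoplus_{k=1}^{\frac{D}{4}-1}\mathrm{End}(\mathbb C^k) & \text{if } D\equiv 0\pmod 4. \end{cases} $$ (ii) The dimension of $\mathbf R$ over $\mathbb C$ is $$\binom{\lfloor D/2\rfloor+3}{3}+\binom{\lceil D/2\rceil+1}{3}.$$ -/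

import Mathlib

/-- The hypercube graph on the power set `Finset Ω` of a finite set `Ω`: two subsets are adjacent
if and only if one of them covers the other with respect to inclusion. -/
def hypercube (Ω : Type*) : SimpleGraph (Finset Ω) where
  Adj x y := x ⋖ y ∨ y ⋖ x
  symm := ⟨fun _ _ h => h.symm⟩
  loopless := ⟨fun x h => by
    rcases h with h | h <;> exact lt_irrefl x h.lt⟩

namespace HypercubeAlgebra

/-- The vector space with basis the power set of `Ω`. -/
abbrev StdModule (Ω : Type*) : Type _ := Finset Ω →₀ ℂ

variable (Ω : Type*) [Fintype Ω]

open Classical in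
/-- The linear map sending a basis vector `x` to the sum of all `y` of the same cardinality at
distance two from `x` in the hypercube. -/
noncomputable def A2J : Module.End ℂ (StdModule Ω) :=
  Finsupp.linearCombination ℂ fun x : Finset Ω =>
    ∑ y : Finset Ω with y.card = x.card ∧ (hypercube Ω).dist x y = 2,
      (Finsupp.single y 1 : StdModule Ω)

open Classical in
/-- The linear map sending a basis vector `x` to the sum of all `y` of different cardinality at
distance two from `x` in the hypercube. -/
noncomputable def A2Jbar : Module.End ℂ (StdModule Ω) :=
  Finsupp.linearCombination ℂ fun x : Finset Ω =>
    ∑ y : Finset Ω with y.card ≠ x.card ∧ (hypercube Ω).dist x y = 2,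
      (Finsupp.single y 1 : StdModule Ω)

/-- The second dual distance operator with respect to the empty set: it sends a basis vector `x`
to `((D - 2|x|)² - D) / 2` times `x`, where `D = |Ω|`. -/
noncomputable def A2star : Module.End ℂ (StdModule Ω) :=
  Finsupp.linearCombination ℂ fun x : Finset Ω =>
    ((((Fintype.card Ω : ℂ) - 2 * (x.card : ℂ)) ^ 2 - (Fintype.card Ω : ℂ)) / 2) •
      (Finsupp.single x 1 : StdModule Ω)

/-- The unital subalgebra of `End(ℂ^X)` generated by the three operators above. -/
noncomputable def R : Subalgebra ℂ (Module.End ℂ (StdModule Ω)) :=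
  Algebra.adjoin ℂ {A2J Ω, A2Jbar Ω, A2star Ω}

/-- The full matrix algebra `End(ℂ^n)`. -/
abbrev MatEnd (n : ℕ) : Type := Module.End ℂ (Fin n → ℂ)

/-- The direct sum of the algebras `End(ℂ^k)` for `1 ≤ k ≤ m` (the zero algebra if `m = 0`). -/
abbrev SumEnd (m : ℕ) : Type := (k : Finset.Icc 1 m) → MatEnd k.1

end HypercubeAlgebra

/-! Adding or removing one element gives operators R and L which, with the level operator, make ℂ^X
a module for sl₂. The generators are polynomials in them: `two_smul_A2J` expresses `A2J` through LR
+ RL, `two_smul_A2Jbar` expresses `A2Jbar` through R² + L², and `A2star_eq` makes `A2star` quadratic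
in the level. A lowest weight vector of level r spans a string of length m + 1 with m = D - 2r.
Every r ≤ D/2 occurs (`exists_isLowest`), and an operator vanishing on all strings is zero
(`eq_zero_of_ladder`). On a string, `A2J` and `A2star` are diagonal, `A2Jbar` moves positions by ±2,
and all these formulas are invariant under the reflection k ↦ m - k (`IsString.reflect`).

Each string therefore splits by the parity of the position. If D is odd, so is m, and reflection
exchanges the two halves: each m gives one isomorphism type, of dimension (m + 1)/2. If D is even,
reflection preserves both halves and splits them into symmetric and antisymmetric parts, up to four
sectors for each m. Sorting the sectors by dimension gives the multiplicities 4, 7 and 8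
(`sectorOf`).

What remains is that the generators produce the full product of matrix algebras. On each block
`A2Jbar` is tridiagonal with nonzero entries beside the diagonal, so a single diagonal matrix unit
yields the whole block (`matUnit_mem_of_isJacobi`). Such a unit is obtained by separating the
initial position of the block from all other positions by diagonal elements: the eigenvalues of
`A2star` and `A2J` determine m and the squared weight (`Block.eq_of_eig_eq`), which suffices for odd
D. For even D, `eq_top_of_sectors` separates the sectors of one string. Finally
`nonempty_adjoin_algEquiv` transports the result to R, and the dimension is a sum of squares. -/

namespace HypercubeAlgebra

/-! ### The sl₂ operators and the generators expressed through them. -/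

section Operators

variable {Ω : Type*}

/-- The raising operator: a basis vector `x` is sent to the sum of all `y` covering `x`. -/
noncomputable def raise (Ω : Type*) [Fintype Ω] [DecidableEq Ω] : Module.End ℂ (StdModule Ω) :=
  Finsupp.linearCombination ℂ fun x : Finset Ω =>
    ∑ a ∈ xᶜ, (Finsupp.single (insert a x) 1 : StdModule Ω)

/-- The lowering operator: a basis vector `x` is sent to the sum of all `y` covered by `x`. -/
noncomputable def lower (Ω : Type*) [DecidableEq Ω] : Module.End ℂ (StdModule Ω) :=
  Finsupp.linearCombination ℂ fun x : Finset Ω =>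
    ∑ a ∈ x, (Finsupp.single (x.erase a) 1 : StdModule Ω)

/-- The diagonal operator with eigenvalue `|x|` at a basis vector `x`. -/
noncomputable def level (Ω : Type*) : Module.End ℂ (StdModule Ω) :=
  Finsupp.linearCombination ℂ fun x : Finset Ω =>
    (x.card : ℂ) • (Finsupp.single x 1 : StdModule Ω)

/-- The sum of all sets obtained from `x` by exchanging one element. -/
noncomputable def exchange [Fintype Ω] [DecidableEq Ω] (x : Finset Ω) : StdModule Ω :=
  ∑ p ∈ xᶜ ×ˢ x, Finsupp.single ((insert p.1 x).erase p.2) 1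

lemma raise_single [Fintype Ω] [DecidableEq Ω] (x : Finset Ω) :
    raise Ω (Finsupp.single x 1) = ∑ a ∈ xᶜ, Finsupp.single (insert a x) 1 := by
  simp [raise, Finsupp.linearCombination_single]

lemma lower_single [DecidableEq Ω] (x : Finset Ω) :
    lower Ω (Finsupp.single x 1) = ∑ a ∈ x, Finsupp.single (x.erase a) 1 := by
  simp [lower, Finsupp.linearCombination_single]

lemma level_single (x : Finset Ω) :
    level Ω (Finsupp.single x 1) = (x.card : ℂ) • Finsupp.single x 1 := by
  simp [level, Finsupp.linearCombination_single]

lemma A2star_single [Fintype Ω] (x : Finset Ω) :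
    A2star Ω (Finsupp.single x 1) =
      ((((Fintype.card Ω : ℂ) - 2 * (x.card : ℂ)) ^ 2 - (Fintype.card Ω : ℂ)) / 2) •
        Finsupp.single x 1 := by
  rw [A2star, Finsupp.linearCombination_single, one_smul]

lemma stdModule_hom_ext {M : Type*} [AddCommMonoid M] [Module ℂ M] {f g : StdModule Ω →ₗ[ℂ] M}
    (h : ∀ x : Finset Ω, f (Finsupp.single x 1) = g (Finsupp.single x 1)) : f = g := by
  ext x
  simpa using h x

/-- Removing the element just added returns x, once for each element outside x; removing any other
element is an exchange. In the opposite order the same `exchange` term appears, so it cancels in the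
commutator. -/
lemma lower_raise_single [Fintype Ω] [DecidableEq Ω] (x : Finset Ω) :
    lower Ω (raise Ω (Finsupp.single x 1)) =
      ((Fintype.card Ω : ℂ) - x.card) • Finsupp.single x 1 + exchange x := by
  rw [raise_single, map_sum, exchange, Finset.sum_product,
    ← Nat.cast_sub (Finset.card_le_univ x), ← Finset.card_compl, Nat.cast_smul_eq_nsmul,
    ← Finset.sum_const, ← Finset.sum_add_distrib]
  refine Finset.sum_congr rfl fun a ha => ?_
  rw [Finset.mem_compl] at ha
  rw [lower_single, Finset.sum_insert ha, Finset.erase_insert ha]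

lemma raise_lower_single [Fintype Ω] [DecidableEq Ω] (x : Finset Ω) :
    raise Ω (lower Ω (Finsupp.single x 1)) = (x.card : ℂ) • Finsupp.single x 1 + exchange x := by
  rw [lower_single, map_sum, exchange, Finset.sum_product_right, Nat.cast_smul_eq_nsmul,
    ← Finset.sum_const, ← Finset.sum_add_distrib]
  refine Finset.sum_congr rfl fun b hb => ?_
  rw [raise_single, Finset.compl_erase, Finset.sum_insert (by simpa using hb),
    Finset.insert_erase hb]
  congr 1
  refine Finset.sum_congr rfl fun a ha => ?_
  rw [Finset.mem_compl] at ha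
  rw [Finset.erase_insert_of_ne (ne_of_mem_of_not_mem hb ha).symm]

lemma lower_mul_raise [Fintype Ω] [DecidableEq Ω] :
    lower Ω * raise Ω = raise Ω * lower Ω + (Fintype.card Ω : ℂ) • 1 - (2 : ℂ) • level Ω := by
  refine stdModule_hom_ext fun x => ?_
  simp only [Module.End.mul_apply, LinearMap.sub_apply, LinearMap.add_apply, LinearMap.smul_apply,
    lower_raise_single, raise_lower_single, level_single, Module.End.one_apply]
  module

lemma level_mul_raise [Fintype Ω] [DecidableEq Ω] : level Ω * raise Ω = raise Ω * level Ω + raise Ω := by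
  refine stdModule_hom_ext fun x => ?_
  simp only [Module.End.mul_apply, LinearMap.add_apply, level_single, map_smul, raise_single,
    map_sum, Finset.smul_sum, ← Finset.sum_add_distrib]
  refine Finset.sum_congr rfl fun a ha => ?_
  rw [Finset.card_insert_of_notMem (by simpa using ha)]
  push_cast
  module

lemma A2star_eq [Fintype Ω] :
    A2star Ω = (1 / 2 : ℂ) • (((Fintype.card Ω : ℂ) • 1 - (2 : ℂ) • level Ω) ^ 2
      - (Fintype.card Ω : ℂ) • 1) := by
  refine stdModule_hom_ext fun x => ?_
  simp only [A2star_single, pow_two, LinearMap.smul_apply, LinearMap.sub_apply,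
    Module.End.mul_apply, Module.End.one_apply, level_single, map_sub, map_smul]
  module

lemma hypercube_adj_iff [DecidableEq Ω] (x y : Finset Ω) :
    (hypercube Ω).Adj x y ↔ (symmDiff x y).card = 1 := by
  change (x ⋖ y ∨ y ⋖ x) ↔ _
  rw [Finset.covBy_iff_exists_insert, Finset.covBy_iff_exists_erase, Finset.card_eq_one]
  constructor
  · rintro (⟨a, ha, rfl⟩ | ⟨a, ha, rfl⟩) <;> exact ⟨a, by ext b; grind [Finset.mem_symmDiff, Finset.mem_compl]⟩
  · rintro ⟨a, h⟩
    have h' : y = symmDiff x {a} := by rw [← h, symmDiff_symmDiff_cancel_left]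
    subst h'
    by_cases ha : a ∈ x
    · exact Or.inr ⟨a, ha, by ext b; grind [Finset.mem_symmDiff, Finset.mem_compl]⟩
    · exact Or.inl ⟨a, ha, by ext b; grind [Finset.mem_symmDiff, Finset.mem_compl]⟩

/-- Distance two means distinct, nonadjacent and having a common neighbour. The triangle inequality
for symmetric differences bounds the cardinality by two; conversely, toggling one differing element
gives a common neighbour. -/
lemma hypercube_dist_eq_two_iff [DecidableEq Ω] (x y : Finset Ω) :
    (hypercube Ω).dist x y = 2 ↔ (symmDiff x y).card = 2 := by
  have h2 : (hypercube Ω).dist x y = 2 ↔ (hypercube Ω).edist x y = 2 := by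
    rw [SimpleGraph.dist, ENat.toNat_eq_iff (by norm_num)]
    rfl
  rw [h2, SimpleGraph.edist_eq_two_iff]
  constructor
  · rintro ⟨hne, hadj, z, hz⟩
    rw [SimpleGraph.mem_commonNeighbors, hypercube_adj_iff, hypercube_adj_iff] at hz
    rw [hypercube_adj_iff] at hadj
    have h0 : (symmDiff x y).card ≠ 0 := by
      rwa [Finset.card_ne_zero, Finset.nonempty_iff_ne_empty, ← Finset.bot_eq_empty, Ne,
        symmDiff_eq_bot]
    have hle : (symmDiff x y).card ≤ (symmDiff x z).card + (symmDiff z y).card :=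
      (Finset.card_le_card (symmDiff_triangle x z y)).trans (Finset.card_union_le _ _)
    rw [symmDiff_comm z y, hz.1, hz.2] at hle
    omega
  · intro h
    refine ⟨?_, ?_, ?_⟩
    · rintro rfl
      simp at h
    · rw [hypercube_adj_iff]
      omega
    · obtain ⟨a, ha⟩ : (symmDiff x y).Nonempty := Finset.card_pos.mp (by omega)
      refine ⟨symmDiff x {a}, ?_⟩
      rw [SimpleGraph.mem_commonNeighbors, hypercube_adj_iff, hypercube_adj_iff,
        symmDiff_symmDiff_cancel_left, Finset.card_singleton, ← symmDiff_assoc,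
        symmDiff_comm y x]
      refine ⟨rfl, ?_⟩
      have : symmDiff (symmDiff x y) {a} = (symmDiff x y).erase a := by ext b; grind [Finset.mem_symmDiff, Finset.mem_compl]
      rw [this, Finset.card_erase_of_mem ha, h]

lemma A2J_single [Fintype Ω] [DecidableEq Ω] (x : Finset Ω) :
    A2J Ω (Finsupp.single x 1) = exchange x := by
  classical
  rw [A2J, Finsupp.linearCombination_single, one_smul, exchange]
  symm
  refine Finset.sum_bij (fun p _ => (insert p.1 x).erase p.2) ?_ ?_ ?_ fun _ _ => rfl
  · rintro ⟨a, b⟩ hp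
    simp only [Finset.mem_product, Finset.mem_compl] at hp
    simp only [Finset.mem_filter, Finset.mem_univ, true_and, hypercube_dist_eq_two_iff]
    have h : symmDiff x ((insert a x).erase b) = {a, b} := by ext c; grind [Finset.mem_symmDiff, Finset.mem_compl]
    rw [h, Finset.card_pair (by grind [Finset.mem_symmDiff, Finset.mem_compl]), Finset.card_erase_of_mem (by grind [Finset.mem_symmDiff, Finset.mem_compl]),
      Finset.card_insert_of_notMem hp.1]
    exact ⟨rfl, rfl⟩
  · rintro ⟨a, b⟩ hp ⟨a', b'⟩ hp' h
    simp only [Finset.mem_product, Finset.mem_compl] at hp hp' h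
    have h1 := congrArg (fun y => a ∈ y) h
    have h2 := congrArg (fun y => b ∈ y) h
    grind [Finset.mem_symmDiff, Finset.mem_compl]
  · intro y hy
    simp only [Finset.mem_filter, Finset.mem_univ, true_and, hypercube_dist_eq_two_iff] at hy
    have h1 := Finset.card_sdiff_add_card_inter x y
    have h2 := Finset.card_sdiff_add_card_inter y x
    rw [Finset.inter_comm] at h2
    have h3 : (symmDiff x y).card = (x \ y).card + (y \ x).card :=
      Finset.card_union_of_disjoint disjoint_sdiff_sdiff
    obtain ⟨b, hb⟩ := Finset.card_eq_one.mp (show (x \ y).card = 1 by omega)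
    obtain ⟨a, ha⟩ := Finset.card_eq_one.mp (show (y \ x).card = 1 by omega)
    refine ⟨(a, b), ?_, ?_⟩
    · have := ha.ge (Finset.mem_singleton_self a)
      have := hb.ge (Finset.mem_singleton_self b)
      grind [Finset.mem_symmDiff, Finset.mem_compl]
    · ext c
      have := Finset.ext_iff.mp ha c
      have := Finset.ext_iff.mp hb c
      grind [Finset.mem_symmDiff, Finset.mem_compl]

/-- Summing over ordered pairs of distinct elements counts each two-element subset twice. -/
lemma sum_offDiag_eq_two_mul {α M : Type*} [DecidableEq α] [AddCommMonoid M] (s : Finset α)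
    (f : Finset α → M) :
    ∑ p ∈ s.offDiag, f {p.1, p.2} = 2 • ∑ t ∈ s.powersetCard 2, f t := by
  rw [Finset.smul_sum, ← Finset.sum_fiberwise_of_maps_to (t := s.powersetCard 2)
    (g := fun p : α × α => ({p.1, p.2} : Finset α))]
  · refine Finset.sum_congr rfl fun t ht => ?_
    rw [Finset.mem_powersetCard] at ht
    have h : {p ∈ s.offDiag | ({p.1, p.2} : Finset α) = t} = t.offDiag := by
      ext ⟨a, b⟩
      simp only [Finset.mem_filter, Finset.mem_offDiag]
      constructor
      · rintro ⟨⟨_, _, h⟩, rfl⟩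
        simpa using h
      · rintro ⟨ha, hb, h⟩
        refine ⟨⟨ht.1 ha, ht.1 hb, h⟩, Finset.eq_of_subset_of_card_le (by grind [Finset.mem_symmDiff, Finset.mem_compl]) ?_⟩
        rw [Finset.card_pair h, ht.2]
    rw [h, Finset.sum_congr rfl (g := fun _ => f t), Finset.sum_const, Finset.offDiag_card, ht.2]
    intro p hp
    rw [← h, Finset.mem_filter] at hp
    rw [hp.2]
  · rintro ⟨a, b⟩ hp
    rw [Finset.mem_offDiag] at hp
    rw [Finset.mem_powersetCard, Finset.card_pair hp.2.2]
    exact ⟨by grind [Finset.mem_symmDiff, Finset.mem_compl], rfl⟩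

lemma raise_raise_single [Fintype Ω] [DecidableEq Ω] (x : Finset Ω) :
    raise Ω (raise Ω (Finsupp.single x 1)) =
      2 • ∑ t ∈ xᶜ.powersetCard 2, Finsupp.single (x ∪ t) 1 := by
  rw [← sum_offDiag_eq_two_mul xᶜ fun t => (Finsupp.single (x ∪ t) 1 : StdModule Ω)]
  rw [raise_single, map_sum]
  simp only [raise_single]
  rw [Finset.sum_sigma']
  refine Finset.sum_bij (fun p _ => (p.1, p.2)) ?_ ?_ ?_ ?_
  · rintro ⟨a, b⟩ h
    simp only [Finset.mem_sigma, Finset.mem_compl, Finset.mem_offDiag] at h ⊢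
    grind [Finset.mem_symmDiff, Finset.mem_compl]
  · rintro ⟨a, b⟩ _ ⟨a', b'⟩ _ h
    grind [Finset.mem_symmDiff, Finset.mem_compl]
  · rintro ⟨a, b⟩ h
    simp only [Finset.mem_compl, Finset.mem_offDiag] at h
    refine ⟨⟨a, b⟩, ?_, rfl⟩
    simp only [Finset.mem_sigma, Finset.mem_compl]
    grind [Finset.mem_symmDiff, Finset.mem_compl]
  · rintro ⟨a, b⟩ _
    congr 1
    grind [Finset.mem_symmDiff, Finset.mem_compl]

lemma lower_lower_single [DecidableEq Ω] (x : Finset Ω) :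
    lower Ω (lower Ω (Finsupp.single x 1)) =
      2 • ∑ t ∈ x.powersetCard 2, Finsupp.single (x \ t) 1 := by
  rw [← sum_offDiag_eq_two_mul x fun t => (Finsupp.single (x \ t) 1 : StdModule Ω)]
  rw [lower_single, map_sum]
  simp only [lower_single]
  rw [Finset.sum_sigma']
  refine Finset.sum_bij (fun p _ => (p.1, p.2)) ?_ ?_ ?_ ?_
  · rintro ⟨a, b⟩ h
    simp only [Finset.mem_sigma, Finset.mem_offDiag] at h ⊢
    grind [Finset.mem_symmDiff, Finset.mem_compl]
  · rintro ⟨a, b⟩ _ ⟨a', b'⟩ _ h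
    grind [Finset.mem_symmDiff, Finset.mem_compl]
  · rintro ⟨a, b⟩ h
    simp only [Finset.mem_offDiag] at h
    refine ⟨⟨a, b⟩, ?_, rfl⟩
    simp only [Finset.mem_sigma]
    grind [Finset.mem_symmDiff, Finset.mem_compl]
  · rintro ⟨a, b⟩ _
    congr 1
    grind [Finset.mem_symmDiff, Finset.mem_compl]

/-- Two sets of different size whose symmetric difference has two elements are nested: otherwise
each difference would have one element and the sizes would agree. -/
lemma A2Jbar_single [Fintype Ω] [DecidableEq Ω] (x : Finset Ω) :
    A2Jbar Ω (Finsupp.single x 1) =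
      ∑ t ∈ xᶜ.powersetCard 2, Finsupp.single (x ∪ t) 1 +
        ∑ t ∈ x.powersetCard 2, Finsupp.single (x \ t) 1 := by
  classical
  have hinj₁ : Set.InjOn (fun t => x ∪ t) (xᶜ.powersetCard 2) := by
    intro s hs t ht h
    simp only [Finset.mem_coe, Finset.mem_powersetCard] at hs ht
    ext c
    have := @hs.1 c
    have := @ht.1 c
    have := Finset.ext_iff.mp h c
    grind [Finset.mem_symmDiff, Finset.mem_compl]
  have hinj₂ : Set.InjOn (fun t => x \ t) (x.powersetCard 2) := by
    intro s hs t ht h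
    simp only [Finset.mem_coe, Finset.mem_powersetCard] at hs ht
    ext c
    have := @hs.1 c
    have := @ht.1 c
    have := Finset.ext_iff.mp h c
    grind [Finset.mem_symmDiff, Finset.mem_compl]
  rw [A2Jbar, Finsupp.linearCombination_single, one_smul,
    ← Finset.sum_image (f := fun y => (Finsupp.single y 1 : StdModule Ω)) hinj₁,
    ← Finset.sum_image (f := fun y => (Finsupp.single y 1 : StdModule Ω)) hinj₂,
    ← Finset.sum_union]
  · refine Finset.sum_congr ?_ fun _ _ => rfl
    ext y
    simp only [Finset.mem_filter, Finset.mem_univ, true_and, hypercube_dist_eq_two_iff,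
      Finset.mem_union, Finset.mem_image, Finset.mem_powersetCard]
    have h1 := Finset.card_sdiff_add_card_inter x y
    have h2 := Finset.card_sdiff_add_card_inter y x
    rw [Finset.inter_comm] at h2
    have h3 : (symmDiff x y).card = (x \ y).card + (y \ x).card :=
      Finset.card_union_of_disjoint disjoint_sdiff_sdiff
    constructor
    · rintro ⟨h4, h5⟩
      have h6 : (x \ y).card = 0 ∨ (y \ x).card = 0 := by omega
      rcases h6 with h6 | h6
      · refine Or.inl ⟨y \ x, ⟨by grind [Finset.mem_symmDiff, Finset.mem_compl], by omega⟩, ?_⟩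
        rw [Finset.card_eq_zero, Finset.sdiff_eq_empty_iff_subset] at h6
        grind [Finset.mem_symmDiff, Finset.mem_compl]
      · refine Or.inr ⟨x \ y, ⟨by grind [Finset.mem_symmDiff, Finset.mem_compl], by omega⟩, ?_⟩
        rw [Finset.card_eq_zero, Finset.sdiff_eq_empty_iff_subset] at h6
        grind [Finset.mem_symmDiff, Finset.mem_compl]
    · rintro (⟨t, ⟨ht, ht2⟩, rfl⟩ | ⟨t, ⟨ht, ht2⟩, rfl⟩)
      · have h7 : (x ∪ t) \ x = t := by
          ext c
          have := @ht c
          grind [Finset.mem_symmDiff, Finset.mem_compl]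
        have h8 : x \ (x ∪ t) = ∅ := by grind [Finset.mem_symmDiff, Finset.mem_compl]
        rw [h7] at h2 h3
        rw [h8, Finset.card_empty] at h1 h3
        omega
      · have h7 : x \ (x \ t) = t := by
          ext c
          have := @ht c
          grind [Finset.mem_symmDiff, Finset.mem_compl]
        have h8 : (x \ t) \ x = ∅ := by grind [Finset.mem_symmDiff, Finset.mem_compl]
        rw [h7] at h1 h3
        rw [h8, Finset.card_empty] at h2 h3
        omega
  · rw [Finset.disjoint_left]
    simp only [Finset.mem_image, Finset.mem_powersetCard]
    rintro _ ⟨t, ht, rfl⟩ ⟨s, hs, h⟩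
    obtain ⟨c, hc⟩ := Finset.card_pos.mp (show 0 < t.card by omega)
    have := ht.1 hc
    have := Finset.ext_iff.mp h c
    grind [Finset.mem_symmDiff, Finset.mem_compl]

lemma two_smul_A2J [Fintype Ω] [DecidableEq Ω] :
    (2 : ℂ) • A2J Ω =
      lower Ω * raise Ω + raise Ω * lower Ω - (Fintype.card Ω : ℂ) • 1 := by
  refine stdModule_hom_ext fun x => ?_
  simp only [Module.End.mul_apply, LinearMap.sub_apply, LinearMap.add_apply, LinearMap.smul_apply,
    lower_raise_single, raise_lower_single, A2J_single, Module.End.one_apply]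
  module

lemma two_smul_A2Jbar [Fintype Ω] [DecidableEq Ω] :
    (2 : ℂ) • A2Jbar Ω = raise Ω * raise Ω + lower Ω * lower Ω := by
  refine stdModule_hom_ext fun x => ?_
  simp only [Module.End.mul_apply, LinearMap.add_apply, LinearMap.smul_apply,
    raise_raise_single, lower_lower_single, A2Jbar_single]
  module

end Operators

/-! ### Lowest weight vectors and the strings they generate. -/

section Strings

variable {Ω : Type*}

lemma level_apply (f : StdModule Ω) (x : Finset Ω) : level Ω f x = x.card * f x := by
  have h : (Finsupp.lapply x).comp (level Ω) =
      (x.card : ℂ) • (Finsupp.lapply x : StdModule Ω →ₗ[ℂ] ℂ) := by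
    refine stdModule_hom_ext fun y => ?_
    rcases eq_or_ne y x with rfl | h <;> simp_all [level_single]
  simpa using LinearMap.congr_fun h f

lemma lower_apply [Fintype Ω] [DecidableEq Ω] (f : StdModule Ω) (y : Finset Ω) :
    lower Ω f y = ∑ a ∈ yᶜ, f (insert a y) := by
  have h : (Finsupp.lapply y).comp (lower Ω) =
      (∑ a ∈ yᶜ, Finsupp.lapply (insert a y) : StdModule Ω →ₗ[ℂ] ℂ) := by
    refine stdModule_hom_ext fun x => ?_
    rw [LinearMap.comp_apply, lower_single, map_sum, LinearMap.sum_apply]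
    simp only [Finsupp.lapply_apply, Finsupp.single_apply]
    rw [← Finset.sum_filter, ← Finset.sum_filter]
    refine Finset.sum_congr ?_ fun _ _ => rfl
    ext a
    simp only [Finset.mem_filter, Finset.mem_compl]
    constructor
    · rintro ⟨ha, rfl⟩
      simp [ha]
    · rintro ⟨ha, rfl⟩
      simp [ha]
  simpa using LinearMap.congr_fun h f

/-- Lowest weight vectors of level `r`. -/
def IsLowest [DecidableEq Ω] (r : ℂ) (v : StdModule Ω) : Prop :=
  level Ω v = r • v ∧ lower Ω v = 0

lemma level_raise_pow [Fintype Ω] [DecidableEq Ω] {r : ℂ} {v : StdModule Ω}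
    (hv : level Ω v = r • v) (k : ℕ) :
    level Ω ((raise Ω ^ k) v) = (r + k) • (raise Ω ^ k) v := by
  induction k with
  | zero => simpa using hv
  | succ k ih =>
    have h := LinearMap.congr_fun (level_mul_raise (Ω := Ω)) ((raise Ω ^ k) v)
    rw [Module.End.mul_apply, LinearMap.add_apply, Module.End.mul_apply, ih, map_smul] at h
    rw [pow_succ', Module.End.mul_apply, h]
    push_cast
    module

lemma lower_raise_pow [Fintype Ω] [DecidableEq Ω] {r : ℂ} {v : StdModule Ω}
    (hv : IsLowest r v) (k : ℕ) :
    lower Ω ((raise Ω ^ (k + 1)) v) =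
      ((k + 1) * (Fintype.card Ω - 2 * r - k) : ℂ) • (raise Ω ^ k) v := by
  have key : ∀ w, lower Ω (raise Ω w) = raise Ω (lower Ω w) + (Fintype.card Ω : ℂ) • w
      - (2 : ℂ) • level Ω w := fun w => by
    simpa using LinearMap.congr_fun (lower_mul_raise (Ω := Ω)) w
  induction k with
  | zero =>
    simp only [zero_add, pow_one, pow_zero, Module.End.one_apply, key, hv.1, hv.2, map_zero]
    push_cast
    module
  | succ k ih =>
    rw [pow_succ', Module.End.mul_apply, key, ih, map_smul, level_raise_pow hv.1,
      ← Module.End.mul_apply, ← pow_succ']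
    push_cast
    module

lemma eq_zero_of_card_lt_level [Fintype Ω] {n : ℕ} (hn : Fintype.card Ω < n)
    {v : StdModule Ω} (hv : level Ω v = (n : ℂ) • v) : v = 0 := by
  ext x
  have h := congrArg (fun f : StdModule Ω => f x) hv
  simp only [level_apply, Finsupp.smul_apply, smul_eq_mul, mul_eq_mul_right_iff, Nat.cast_inj] at h
  rcases h with h | h
  · have := Finset.card_le_univ x
    omega
  · simpa using h

/-- Lowering R^(k+1) v returns R^k v times (k + 1)(D - 2r - k), so the powers stay nonzero as long
as these factors do. -/
lemma raise_pow_ne_zero [Fintype Ω] [DecidableEq Ω] {r : ℂ} {v : StdModule Ω}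
    (hv : IsLowest r v) (h0 : v ≠ 0) (k : ℕ)
    (hk : ∀ j < k, (Fintype.card Ω : ℂ) - 2 * r - j ≠ 0) : (raise Ω ^ k) v ≠ 0 := by
  induction k with
  | zero => simpa using h0
  | succ k ih =>
    intro h
    have h1 := lower_raise_pow hv k
    rw [h, map_zero, eq_comm, smul_eq_zero] at h1
    rcases h1 with h1 | h1
    · exact mul_ne_zero (Nat.cast_add_one_ne_zero k) (hk k (Nat.lt_succ_self k)) h1
    · exact ih (fun j hj => hk j (by omega)) h1

/-- When D < 2r no factor D - 2r - j vanishes, so a nonzero v could be raised beyond level D, where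
there are no sets. -/
lemma eq_zero_of_isLowest [Fintype Ω] [DecidableEq Ω] {r : ℕ} {v : StdModule Ω}
    (hv : IsLowest (r : ℂ) v) (hr : Fintype.card Ω < 2 * r) : v = 0 := by
  by_contra h0
  refine raise_pow_ne_zero hv h0 (Fintype.card Ω + 1) (fun j _ h => ?_) ?_
  · have : (Fintype.card Ω : ℂ) = 2 * r + j := by linear_combination h
    have : Fintype.card Ω = 2 * r + j := by exact_mod_cast this
    omega
  · refine eq_zero_of_card_lt_level (n := r + (Fintype.card Ω + 1)) (by omega) ?_
    rw [level_raise_pow hv.1, Nat.cast_add r]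

/-- A linear functional which vanishes on everything obtained by raising lowest weight vectors is
zero. -/
lemma functional_eq_zero [Fintype Ω] [DecidableEq Ω] (φ : StdModule Ω →ₗ[ℂ] ℂ)
    (h : ∀ (r : ℕ) (v : StdModule Ω), IsLowest (r : ℂ) v → ∀ k, φ ((raise Ω ^ k) v) = 0) :
    φ = 0 := by
  have step : ∀ ψ : StdModule Ω →ₗ[ℂ] ℂ, ψ.comp (raise Ω) = 0 →
      (∀ (r : ℕ) (v : StdModule Ω), IsLowest (r : ℂ) v → ψ v = 0) → ψ = 0 := by
    intro ψ hψ hlow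
    -- L is adjoint to R for the standard Hermitian form, so ψ ∘ R = 0 makes the conjugated
    -- coefficients of ψ on one level a lowest weight vector. The value of ψ there is a sum of
    -- squared moduli, and its vanishing kills each coefficient.
    let f : ℕ → StdModule Ω := fun r => Finsupp.equivFunOnFinite.symm fun x =>
      if x.card = r then (starRingEnd ℂ) (ψ (Finsupp.single x 1)) else 0
    have hf : ∀ r x, f r x = if x.card = r then (starRingEnd ℂ) (ψ (Finsupp.single x 1)) else 0 :=
      fun r x => rfl
    have hfl : ∀ r : ℕ, IsLowest (r : ℂ) (f r) := by
      refine fun r => ⟨?_, ?_⟩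
      · ext x
        rw [level_apply, Finsupp.smul_apply, hf]
        split_ifs with hx
        · rw [hx, smul_eq_mul]
        · simp
      · ext y
        rw [lower_apply, Finsupp.zero_apply]
        have hy := LinearMap.congr_fun hψ (Finsupp.single y 1)
        rw [LinearMap.comp_apply, raise_single, map_sum, LinearMap.zero_apply] at hy
        rw [Finset.sum_congr rfl (g := fun a => if y.card + 1 = r then
          (starRingEnd ℂ) (ψ (Finsupp.single (insert a y) 1)) else 0)]
        · split_ifs
          · rw [← map_sum, hy, map_zero]
          · simp
        · intro a ha
          rw [hf, Finset.card_insert_of_notMem (by simpa using ha)]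
    refine stdModule_hom_ext fun x => ?_
    have h1 := hlow _ _ (hfl x.card)
    have h2 : f x.card = ∑ y, f x.card y • Finsupp.single y 1 := by
      ext z
      simp
    rw [h2, map_sum] at h1
    have h3 : ∀ y, ψ (f x.card y • Finsupp.single y 1) =
        ((if y.card = x.card then Complex.normSq (ψ (Finsupp.single y 1)) else 0 : ℝ) : ℂ) := by
      intro y
      rw [map_smul, hf, smul_eq_mul]
      split_ifs
      · rw [mul_comm, Complex.mul_conj]
      · simp
    simp only [h3] at h1
    rw [← Complex.ofReal_sum, Complex.ofReal_eq_zero, Finset.sum_eq_zero_iff_of_nonneg] at h1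
    · simpa using h1 x (Finset.mem_univ x)
    · intro y _
      split_ifs
      · exact Complex.normSq_nonneg _
      · exact le_rfl
  -- R^(D+1) = 0, and `step` applied to φ ∘ R^j brings the exponent down one at a time to φ itself.
  have hnil : φ.comp (raise Ω ^ (Fintype.card Ω + 1)) = 0 := by
    refine stdModule_hom_ext fun x => ?_
    have : (raise Ω ^ (Fintype.card Ω + 1)) (Finsupp.single x 1) = 0 := by
      refine eq_zero_of_card_lt_level (n := x.card + (Fintype.card Ω + 1)) (by omega) ?_
      rw [level_raise_pow (level_single x), Nat.cast_add x.card]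
    simp [this]
  have hdesc : ∀ j, φ.comp (raise Ω ^ j) = 0 → φ = 0 := by
    intro j
    induction j with
    | zero => exact fun h => h
    | succ j ih =>
      intro hj
      refine ih (step _ ?_ fun r v hv => h r v hv j)
      rwa [LinearMap.comp_assoc, ← Module.End.mul_eq_comp, ← pow_succ]
  exact hdesc _ hnil

/-- Below the middle there are more sets of size r than of size r - 1, so L has a kernel on level r.
Writing the lower level as `y.card + 1 = r` makes it empty when r = 0. -/
lemma exists_isLowest [Fintype Ω] [DecidableEq Ω] {r : ℕ} (hr : 2 * r ≤ Fintype.card Ω) :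
    ∃ v : StdModule Ω, IsLowest (r : ℂ) v ∧ v ≠ 0 := by
  let ext₀ : ({x : Finset Ω // x.card = r} → ℂ) →ₗ[ℂ] StdModule Ω :=
    (Finsupp.lmapDomain ℂ ℂ Subtype.val).comp
      (Finsupp.linearEquivFunOnFinite ℂ ℂ {x : Finset Ω // x.card = r}).symm.toLinearMap
  have hext : Function.Injective ext₀ :=
    (Finsupp.mapDomain_injective Subtype.val_injective).comp (LinearEquiv.injective _)
  have hext₀ : ∀ f x, x.card ≠ r → ext₀ f x = 0 := fun f x hx =>
    Finsupp.mapDomain_of_notMem_range _ _ (by simpa using hx)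
  have hlevel : ∀ f, level Ω (ext₀ f) = (r : ℂ) • ext₀ f := by
    intro f
    ext x
    rw [level_apply, Finsupp.smul_apply, smul_eq_mul]
    by_cases hx : x.card = r
    · rw [hx]
    · rw [hext₀ f x hx, mul_zero, mul_zero]
  have hlow : ∀ f y, y.card + 1 ≠ r → lower Ω (ext₀ f) y = 0 := by
    intro f y hy
    rw [lower_apply]
    refine Finset.sum_eq_zero fun a ha => hext₀ f _ ?_
    rwa [Finset.card_insert_of_notMem (by simpa using ha)]
  let g : ({x : Finset Ω // x.card = r} → ℂ) →ₗ[ℂ] ({y : Finset Ω // y.card + 1 = r} → ℂ) :=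
    LinearMap.pi fun y => (Finsupp.lapply y.1).comp ((lower Ω).comp ext₀)
  have hcard : Fintype.card {y : Finset Ω // y.card + 1 = r} <
      Fintype.card {x : Finset Ω // x.card = r} := by
    rcases r with _ | r
    · simp
    · simp only [Nat.add_right_cancel_iff, Fintype.card_finset_len]
      have h := Nat.choose_succ_right_eq (Fintype.card Ω) r
      have hpos : 0 < (Fintype.card Ω).choose r := Nat.choose_pos (by omega)
      have h1 : r + 1 < Fintype.card Ω - r := by omega
      nlinarith
  obtain ⟨f, hf, hf0⟩ := Submodule.exists_mem_ne_zero_of_ne_bot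
    (LinearMap.ker_ne_bot_of_finrank_lt (f := g) (by simpa using hcard))
  refine ⟨ext₀ f, ⟨hlevel f, ?_⟩, fun h => hf0 (hext (by rw [h, map_zero]))⟩
  ext y
  by_cases hy : y.card + 1 = r
  · exact congrFun hf ⟨y, hy⟩
  · exact hlow f y hy

/-- A sequence of vectors, supported on `0 ≤ k ≤ m`, on which the three operators act in the same
way as on the weight basis `R ^ k v / k!` of an irreducible module of dimension `m + 1`. -/
structure IsString [Fintype Ω] (m : ℕ) (u : ℤ → StdModule Ω) : Prop where
  star (k : ℤ) : A2star Ω (u k) =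
    ((((m : ℂ) - 2 * k) ^ 2 - (Fintype.card Ω : ℂ)) / 2) • u k
  same (k : ℤ) : A2J Ω (u k) =
    ((((k : ℂ) + 1) * (m - k) + (m - k + 1) * k - (Fintype.card Ω : ℂ)) / 2) • u k
  diff (k : ℤ) : A2Jbar Ω (u k) =
    ((((k : ℂ) + 1) * (k + 2)) / 2) • u (k + 2) + (((m - k + 1 : ℂ) * (m - k + 2)) / 2) • u (k - 2)
  eq_zero (k : ℤ) (hk : k < 0 ∨ (m : ℤ) < k) : u k = 0

/-- Reflection would interchange R and L, but the generators are symmetric in them: the two diagonal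
formulas are invariant under k ↦ m - k and the two terms of `diff` change places. -/
lemma IsString.reflect [Fintype Ω] {m : ℕ} {u : ℤ → StdModule Ω} (hu : IsString m u) :
    IsString m fun k => u (m - k) where
  star k := by
    rw [hu.star]
    push_cast
    ring_nf
  same k := by
    rw [hu.same]
    push_cast
    ring_nf
  diff k := by
    rw [hu.diff, add_comm, show (m : ℤ) - (k + 2) = m - k - 2 by ring,
      show (m : ℤ) - (k - 2) = m - k + 2 by ring]
    push_cast
    ring_nf
  eq_zero k hk := hu.eq_zero _ (by omega)

lemma IsString.add_smul [Fintype Ω] {m : ℕ} {u w : ℤ → StdModule Ω} (hu : IsString m u)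
    (hw : IsString m w) (c : ℂ) : IsString m fun k => u k + c • w k where
  star k := by rw [map_add, map_smul, hu.star, hw.star]; module
  same k := by rw [map_add, map_smul, hu.same, hw.same]; module
  diff k := by rw [map_add, map_smul, hu.diff, hw.diff]; module
  eq_zero k hk := by rw [hu.eq_zero k hk, hw.eq_zero k hk, smul_zero, add_zero]

/-- The divided powers `R ^ k v / k!`, extended by zero to negative `k`. -/
noncomputable def ladder [Fintype Ω] [DecidableEq Ω] (v : StdModule Ω) (k : ℤ) : StdModule Ω :=
  if k < 0 then 0 else (k.toNat.factorial : ℂ)⁻¹ • (raise Ω ^ k.toNat) v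

lemma ladder_natCast [Fintype Ω] [DecidableEq Ω] (v : StdModule Ω) (k : ℕ) :
    ladder v k = (k.factorial : ℂ)⁻¹ • (raise Ω ^ k) v := by
  simp [ladder]

lemma ladder_of_neg [Fintype Ω] [DecidableEq Ω] (v : StdModule Ω) {k : ℤ} (hk : k < 0) :
    ladder v k = 0 := by
  simp [ladder, hk]

lemma level_ladder [Fintype Ω] [DecidableEq Ω] {r : ℂ} {v : StdModule Ω}
    (hv : level Ω v = r • v) (k : ℤ) : level Ω (ladder v k) = (r + k) • ladder v k := by
  rcases lt_or_ge k 0 with hk | hk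
  · simp [ladder_of_neg v hk]
  · lift k to ℕ using hk
    rw [ladder_natCast, map_smul, level_raise_pow hv]
    push_cast
    module

lemma raise_ladder [Fintype Ω] [DecidableEq Ω] (v : StdModule Ω) (k : ℤ) :
    raise Ω (ladder v k) = (k + 1 : ℂ) • ladder v (k + 1) := by
  rcases lt_or_ge k 0 with hk | hk
  · rw [ladder_of_neg v hk, map_zero]
    rcases lt_or_ge (k + 1) 0 with hk' | hk'
    · rw [ladder_of_neg v hk', smul_zero]
    · obtain rfl : k = -1 := by omega
      simp
  · lift k to ℕ using hk
    rw [ladder_natCast, ← Nat.cast_succ, ladder_natCast, map_smul, pow_succ',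
      Module.End.mul_apply, smul_smul, Nat.factorial_succ]
    congr 1
    have h1 : ((k : ℂ) + 1) ≠ 0 := Nat.cast_add_one_ne_zero k
    have h2 : (k.factorial : ℂ) ≠ 0 := Nat.cast_ne_zero.mpr k.factorial_ne_zero
    push_cast
    field_simp

lemma lower_ladder [Fintype Ω] [DecidableEq Ω] {r : ℂ} {v : StdModule Ω}
    (hv : IsLowest r v) (k : ℤ) :
    lower Ω (ladder v k) = (Fintype.card Ω - 2 * r - k + 1 : ℂ) • ladder v (k - 1) := by
  rcases lt_trichotomy k 0 with hk | rfl | hk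
  · rw [ladder_of_neg v hk, ladder_of_neg v (by omega), map_zero, smul_zero]
  · rw [ladder_of_neg v (k := 0 - 1) (by omega)]
    simpa [ladder] using hv.2
  · obtain ⟨j, rfl⟩ : ∃ j : ℕ, k = ((j + 1 : ℕ) : ℤ) := ⟨(k - 1).toNat, by omega⟩
    rw [ladder_natCast, map_smul, lower_raise_pow hv, Nat.cast_succ, add_sub_cancel_right,
      ladder_natCast, smul_smul, smul_smul, Nat.factorial_succ]
    congr 1
    have h1 : ((j : ℂ) + 1) ≠ 0 := Nat.cast_add_one_ne_zero j
    have h2 : (j.factorial : ℂ) ≠ 0 := Nat.cast_ne_zero.mpr j.factorial_ne_zero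
    push_cast
    field_simp
    ring

lemma isString_ladder [Fintype Ω] [DecidableEq Ω] {m r : ℕ} (hm : m + 2 * r = Fintype.card Ω)
    {v : StdModule Ω} (hv : IsLowest (r : ℂ) v) : IsString m (ladder v) := by
  have hm' : (Fintype.card Ω : ℂ) = m + 2 * r := by exact_mod_cast hm.symm
  have hlow : ∀ k : ℤ, lower Ω (ladder v k) = (m - k + 1 : ℂ) • ladder v (k - 1) := fun k => by
    rw [lower_ladder hv, hm']
    ring_nf
  -- The factor D - 2r - m is zero, so this vector is again lowest, at a level above D/2.
  have htop : (raise Ω ^ (m + 1)) v = 0 := by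
    refine eq_zero_of_isLowest (r := r + (m + 1)) ⟨?_, ?_⟩ (by omega)
    · rw [level_raise_pow hv.1, Nat.cast_add r]
    · rw [lower_raise_pow hv, hm']
      simp
  refine ⟨fun k => ?_, fun k => ?_, fun k => ?_, fun k hk => ?_⟩
  · rw [A2star_eq, pow_two]
    simp only [LinearMap.smul_apply, LinearMap.sub_apply, Module.End.mul_apply,
      Module.End.one_apply, level_ladder hv.1, map_sub, map_smul]
    rw [hm']
    module
  · have h := LinearMap.congr_fun (two_smul_A2J (Ω := Ω)) (ladder v k)
    simp only [LinearMap.smul_apply, LinearMap.sub_apply, LinearMap.add_apply,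
      Module.End.mul_apply, Module.End.one_apply, raise_ladder, hlow, map_smul] at h
    rw [add_sub_cancel_right, sub_add_cancel] at h
    rw [← inv_smul_smul₀ (two_ne_zero (α := ℂ)) (A2J Ω (ladder v k)), h]
    push_cast
    module
  · have h := LinearMap.congr_fun (two_smul_A2Jbar (Ω := Ω)) (ladder v k)
    simp only [LinearMap.smul_apply, LinearMap.add_apply,
      Module.End.mul_apply, raise_ladder, hlow, map_smul] at h
    rw [add_assoc, sub_sub] at h
    rw [← inv_smul_smul₀ (two_ne_zero (α := ℂ)) (A2Jbar Ω (ladder v k)), h]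
    push_cast
    norm_num
    module
  · rcases hk with hk | hk
    · exact ladder_of_neg v hk
    · obtain ⟨j, rfl⟩ : ∃ j : ℕ, k = ((j + (m + 1) : ℕ) : ℤ) := ⟨(k - m - 1).toNat, by omega⟩
      rw [ladder_natCast, pow_add, Module.End.mul_apply, htop, map_zero, smul_zero]

lemma ladder_ne_zero [Fintype Ω] [DecidableEq Ω] {m r : ℕ} (hm : m + 2 * r = Fintype.card Ω)
    {v : StdModule Ω} (hv : IsLowest (r : ℂ) v) (h0 : v ≠ 0) {k : ℤ} (hk₀ : 0 ≤ k)
    (hkm : k ≤ m) : ladder v k ≠ 0 := by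
  lift k to ℕ using hk₀
  rw [ladder_natCast]
  refine smul_ne_zero (inv_ne_zero (Nat.cast_ne_zero.mpr k.factorial_ne_zero))
    (raise_pow_ne_zero hv h0 k fun j hj h => ?_)
  rw [← hm] at h
  push_cast at h
  have : (m : ℂ) = j := by linear_combination h
  have : m = j := by exact_mod_cast this
  omega

/-- A nonzero entry of a ladder is not a multiple of an entry of a different level. -/
lemma ladder_add_smul_ne_zero [Fintype Ω] [DecidableEq Ω] {r : ℂ} {v : StdModule Ω}
    (hv : level Ω v = r • v) {k l : ℤ} (hkl : k ≠ l) (hk : ladder v k ≠ 0) (c : ℂ) :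
    ladder v k + c • ladder v l ≠ 0 := by
  intro h
  have h1 := congrArg (level Ω) h
  rw [map_add, map_smul, level_ladder hv, level_ladder hv, map_zero] at h1
  have h2 : ((k : ℂ) - l) • ladder v k = 0 := by
    have : ((k : ℂ) - l) • ladder v k =
        ((r + k) • ladder v k + c • (r + l) • ladder v l) - (r + l) •
          (ladder v k + c • ladder v l) := by module
    rw [this, h1, h, smul_zero, sub_zero]
  rcases smul_eq_zero.mp h2 with h3 | h3
  · exact hkl (by exact_mod_cast sub_eq_zero.mp h3)
  · exact hk h3

/-- An operator which vanishes on all ladders is zero. -/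
lemma eq_zero_of_ladder [Fintype Ω] [DecidableEq Ω] (a : Module.End ℂ (StdModule Ω))
    (h : ∀ (r m : ℕ) (v : StdModule Ω), m + 2 * r = Fintype.card Ω → IsLowest (r : ℂ) v →
      ∀ k : ℕ, k ≤ m → a (ladder v k) = 0) : a = 0 := by
  have key : ∀ x, (Finsupp.lapply x).comp a = 0 := by
    refine fun x => functional_eq_zero _ fun r v hv k => ?_
    have : a ((raise Ω ^ k) v) = 0 := by
      rcases lt_or_ge (Fintype.card Ω) (2 * r) with hr | hr
      · rw [eq_zero_of_isLowest hv hr, map_zero, map_zero]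
      · obtain ⟨m, hm⟩ : ∃ m, m + 2 * r = Fintype.card Ω := ⟨_, Nat.sub_add_cancel hr⟩
        have h1 : (raise Ω ^ k) v = (k.factorial : ℂ) • ladder v k := by
          rw [ladder_natCast, smul_inv_smul₀ (Nat.cast_ne_zero.mpr k.factorial_ne_zero)]
        rw [h1, map_smul]
        rcases le_or_gt k m with hk | hk
        · rw [h r m v hm hv k hk, smul_zero]
        · rw [(isString_ladder hm hv).eq_zero k (by omega), map_zero, smul_zero]
    rw [LinearMap.comp_apply, this, map_zero]
  ext x y
  simpa using LinearMap.congr_fun (key y) (Finsupp.single x 1)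

end Strings

/-! ### Generating a product of matrix algebras. -/

section MatrixProducts

/-- A product of matrix algebras. -/
abbrev MatProd {T : Type*} (n : T → ℕ) : Type _ := (t : T) → Matrix (Fin (n t)) (Fin (n t)) ℂ

/-- A subalgebra of `End V` is isomorphic to a product of matrix algebras as soon as its generators
correspond to generators of that product under sufficiently many intertwining maps. -/
lemma nonempty_adjoin_algEquiv {ι T V : Type*} [AddCommGroup V] [Module ℂ V] {n : T → ℕ}
    (g : ι → Module.End ℂ V) (ρ : ι → MatProd n) (E : ∀ t, Set (Fin (n t) → V))
    (hE : ∀ t, ∀ b ∈ E t, ∀ i j, g i (b j) = ∑ l, ρ i t l j • b l)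
    (hlin : ∀ t, ∃ b ∈ E t, LinearIndependent ℂ b)
    (hfaith : ∀ a : Module.End ℂ V, (∀ t, ∀ b ∈ E t, ∀ j, a (b j) = 0) → a = 0)
    (htop : Algebra.adjoin ℂ (Set.range ρ) = ⊤) :
    Nonempty (Algebra.adjoin ℂ (Set.range g) ≃ₐ[ℂ] MatProd n) := by
  -- P turns out to be the graph of the isomorphism. The intertwining relation extends from the
  -- generators to all of P; then `hlin` makes the first projection injective, `hfaith` the second,
  -- and `htop` makes the second surjective.
  let P : Subalgebra ℂ (Module.End ℂ V × MatProd n) :=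
    Algebra.adjoin ℂ (Set.range fun i => (g i, ρ i))
  have hP : ∀ p ∈ P, ∀ t, ∀ b ∈ E t, ∀ j, p.1 (b j) = ∑ l, p.2 t l j • b l := by
    intro p hp t b hb
    induction hp using Algebra.adjoin_induction with
    | mem p hp =>
      obtain ⟨i, rfl⟩ := hp
      exact hE t b hb i
    | algebraMap c =>
      intro j
      simp [Algebra.algebraMap_eq_smul_one, Matrix.one_apply, ite_smul]
    | add p q _ _ hp hq =>
      intro j
      simp [hp, hq, add_smul, Finset.sum_add_distrib]
    | mul p q _ _ hp hq =>
      intro j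
      simp only [Prod.fst_mul, Prod.snd_mul, Module.End.mul_apply, hq, map_sum, map_smul, hp,
        Pi.mul_apply, Matrix.mul_apply, Finset.smul_sum, Finset.sum_smul, smul_smul]
      rw [Finset.sum_comm]
      simp only [mul_comm]
  let φ₁ : P →ₐ[ℂ] Module.End ℂ V := (AlgHom.fst ℂ _ _).comp P.val
  let φ₂ : P →ₐ[ℂ] MatProd n := (AlgHom.snd ℂ _ _).comp P.val
  have h₁ : Function.Injective φ₁ := by
    rw [injective_iff_map_eq_zero]
    rintro ⟨⟨a, M⟩, hp⟩ ha
    change a = 0 at ha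
    subst ha
    ext1
    refine Prod.ext rfl ?_
    funext t
    obtain ⟨b, hb, hli⟩ := hlin t
    ext l j
    exact Fintype.linearIndependent_iff.mp hli _ (hP _ hp t b hb j).symm l
  have h₂ : Function.Injective φ₂ := by
    rw [injective_iff_map_eq_zero]
    rintro ⟨⟨a, M⟩, hp⟩ hM
    change M = 0 at hM
    subst hM
    ext1
    refine Prod.ext (hfaith a fun t b hb j => ?_) rfl
    simpa using hP _ hp t b hb j
  have r₁ : φ₁.range = Algebra.adjoin ℂ (Set.range g) := by
    rw [AlgHom.range_comp, Subalgebra.range_val, AlgHom.map_adjoin, ← Set.range_comp]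
    rfl
  have r₂ : φ₂.range = ⊤ := by
    rw [AlgHom.range_comp, Subalgebra.range_val, AlgHom.map_adjoin, ← Set.range_comp, ← htop]
    rfl
  exact ⟨(Subalgebra.equivOfEq _ _ r₁).symm.trans
    ((AlgEquiv.ofInjective φ₁ h₁).symm.trans
      (AlgEquiv.ofBijective φ₂ ⟨h₂, (AlgHom.range_eq_top φ₂).mp r₂⟩))⟩

/-- The level sets of a member of a subalgebra of functions on a finite set have their indicator
functions in the subalgebra. -/
lemma indicator_mem_subalgebra {S : Type*} [Fintype S] (B : Subalgebra ℂ (S → ℂ)) {f : S → ℂ}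
    (hf : f ∈ B) (v : ℂ) : (fun s => if f s = v then 1 else 0) ∈ B := by
  classical
  -- The Lagrange interpolation polynomial for the values of f, evaluated at f.
  have h : (fun s => if f s = v then (1 : ℂ) else 0) =
      ∏ w ∈ (Finset.univ.image f).erase v, (v - w)⁻¹ • (f - algebraMap ℂ (S → ℂ) w) := by
    funext s
    rw [Finset.prod_apply]
    simp only [Pi.smul_apply, Pi.sub_apply, Pi.algebraMap_apply, Algebra.algebraMap_self,
      RingHom.id_apply, smul_eq_mul]
    split_ifs with hs
    · rw [Finset.prod_eq_one]
      intro w hw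
      rw [hs, inv_mul_cancel₀ (sub_ne_zero.mpr (Finset.ne_of_mem_erase hw).symm)]
    · rw [Finset.prod_eq_zero (i := f s) (by simp [hs]) (by simp)]
  rw [h]
  exact Subalgebra.prod_mem _ fun w _ =>
    B.smul_mem (B.sub_mem hf (B.algebraMap_mem w)) _

/-- A finite Stone–Weierstrass argument: multiply, over all s ≠ s₀, the indicators of the level set
through s₀ of a function separating s from s₀. -/
lemma single_mem_subalgebra {S : Type*} [Fintype S] [DecidableEq S] (B : Subalgebra ℂ (S → ℂ))
    (s₀ : S) (h : ∀ s ≠ s₀, ∃ f ∈ B, f s ≠ f s₀) : Pi.single s₀ 1 ∈ B := by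
  choose! f hfB hf using h
  have h : (Pi.single s₀ 1 : S → ℂ) =
      ∏ s ∈ Finset.univ.erase s₀, fun s' => if f s s' = f s s₀ then 1 else 0 := by
    funext s
    rw [Finset.prod_apply]
    rcases eq_or_ne s s₀ with rfl | hs
    · simp
    · rw [Pi.single_eq_of_ne hs, Finset.prod_eq_zero (i := s) (by simp [hs]) (by simp [hf s hs])]
  rw [h]
  exact Subalgebra.prod_mem _ fun s hs =>
    indicator_mem_subalgebra B (hfB s (Finset.ne_of_mem_erase hs)) _

variable {T : Type*} {n : T → ℕ}

/-- Diagonal elements of a product of matrix algebras. -/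
noncomputable def diagHom (n : T → ℕ) : ((Σ t, Fin (n t)) → ℂ) →ₐ[ℂ] MatProd n where
  toFun f t := Matrix.diagonal fun i => f ⟨t, i⟩
  map_one' := by funext t; exact Matrix.diagonal_one
  map_mul' f g := by funext t; exact (Matrix.diagonal_mul_diagonal _ _).symm
  map_zero' := by funext t; exact Matrix.diagonal_zero
  map_add' f g := by funext t; exact (Matrix.diagonal_add _ _).symm
  commutes' c := by
    funext t
    ext i j
    simp [Matrix.diagonal_apply, Algebra.algebraMap_eq_smul_one, Matrix.one_apply]

lemma diagHom_apply (f : (Σ t, Fin (n t)) → ℂ) (t : T) :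
    diagHom n f t = Matrix.diagonal fun i => f ⟨t, i⟩ := rfl

/-- Matrix units of a product of matrix algebras. -/
noncomputable def matUnit [DecidableEq T] (t : T) (i j : Fin (n t)) : MatProd n :=
  Pi.single t (Matrix.single i j 1)

lemma matUnit_mul_matUnit [DecidableEq T] (t : T) (i j k : Fin (n t)) :
    matUnit t i j * matUnit t j k = (matUnit t i k : MatProd n) := by
  rw [matUnit, matUnit, ← Pi.single_mul, Matrix.single_mul_single_same, one_mul, matUnit]

lemma diagHom_single [DecidableEq T] (t : T) (i : Fin (n t)) :
    diagHom n (Pi.single ⟨t, i⟩ 1) = matUnit t i i := by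
  funext t'
  rw [diagHom_apply, matUnit]
  rcases eq_or_ne t' t with rfl | h
  · rw [Pi.single_eq_same]
    ext a b
    rw [Matrix.diagonal_apply, Matrix.single_apply]
    by_cases hab : a = b
    · subst hab
      by_cases hai : a = i
      · subst hai
        simp
      · rw [Pi.single_eq_of_ne (by simpa using hai)]
        simp [Ne.symm hai]
    · rw [if_neg hab, if_neg (fun h => hab (h.1.symm.trans h.2))]
  · rw [Pi.single_eq_of_ne h]
    ext a b
    rw [Matrix.diagonal_apply]
    split_ifs
    · rw [Pi.single_eq_of_ne (fun h' => h (congrArg Sigma.fst h'))]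
      rfl
    · rfl

lemma single_sum_matProd [DecidableEq T] {ι : Type*} (s : Finset ι) (t : T)
    (f : ι → Matrix (Fin (n t)) (Fin (n t)) ℂ) :
    (Pi.single t (∑ i ∈ s, f i) : MatProd n) = ∑ i ∈ s, Pi.single t (f i) :=
  map_sum (AddMonoidHom.single (fun t => Matrix (Fin (n t)) (Fin (n t)) ℂ) t) f s

lemma mul_matUnit [DecidableEq T] (X : MatProd n) (t : T) (i j : Fin (n t)) :
    X * matUnit t i j = ∑ l, X t l i • matUnit t l j := by
  have h : ∀ l, X t l i • (matUnit t l j : MatProd n) =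
      Pi.single t (X t l i • Matrix.single l j 1) := fun l => by
    rw [matUnit, Pi.single_smul]
  simp only [h]
  rw [← single_sum_matProd]
  funext t'
  rcases eq_or_ne t' t with rfl | ht
  · rw [Pi.mul_apply, matUnit, Pi.single_eq_same, Pi.single_eq_same]
    ext a b
    by_cases hb : j = b <;> simp [Matrix.sum_apply, Matrix.single_apply, Matrix.mul_apply, hb]
  · simp [matUnit, Pi.single_eq_of_ne ht]

lemma matUnit_mul [DecidableEq T] (X : MatProd n) (t : T) (i j : Fin (n t)) :
    matUnit t i j * X = ∑ l, X t j l • matUnit t i l := by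
  have h : ∀ l, X t j l • (matUnit t i l : MatProd n) =
      Pi.single t (X t j l • Matrix.single i l 1) := fun l => by
    rw [matUnit, Pi.single_smul]
  simp only [h]
  rw [← single_sum_matProd]
  funext t'
  rcases eq_or_ne t' t with rfl | ht
  · rw [Pi.mul_apply, matUnit, Pi.single_eq_same, Pi.single_eq_same]
    ext a b
    by_cases hb : i = a <;> simp [Matrix.sum_apply, Matrix.single_apply, Matrix.mul_apply, hb]
  · simp [matUnit, Pi.single_eq_of_ne ht]

/-- Tridiagonal matrices with nonzero entries next to the diagonal. -/
structure IsJacobi {m : ℕ} (X : Matrix (Fin m) (Fin m) ℂ) : Prop where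
  lower_ne_zero (i j : Fin m) (h : (i : ℕ) = j + 1) : X i j ≠ 0
  upper_ne_zero (i j : Fin m) (h : (j : ℕ) = i + 1) : X i j ≠ 0
  lower_eq_zero (i j : Fin m) (h : (j : ℕ) + 1 < i) : X i j = 0
  upper_eq_zero (i j : Fin m) (h : (i : ℕ) + 1 < j) : X i j = 0

/-- If a subspace contains all terms but one of a linear combination, and also the combination, then
it contains the remaining term when its coefficient is nonzero. -/
lemma mem_of_sum_smul_mem {ι M : Type*} [Fintype ι] [AddCommGroup M] [Module ℂ M]
    (B : Submodule ℂ M) (c : ι → ℂ) (v : ι → M) (i : ι) (hsum : ∑ l, c l • v l ∈ B)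
    (hi : c i ≠ 0) (h : ∀ l ≠ i, c l ≠ 0 → v l ∈ B) : v i ∈ B := by
  classical
  rw [← Finset.add_sum_erase _ _ (Finset.mem_univ i)] at hsum
  rw [← B.smul_mem_iff hi]
  refine (B.add_mem_iff_left (B.sum_mem fun l hl => ?_)).mp hsum
  by_cases hl0 : c l = 0
  · rw [hl0, zero_smul]
    exact B.zero_mem
  · exact B.smul_mem _ (h l (Finset.ne_of_mem_erase hl) hl0)

/-- Multiplying the unit at (k, 0) on the left by X gives a nonzero multiple of the unit at (k + 1,
0) plus units higher in that column, so the initial column is obtained by induction. Multiplication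
on the right gives the initial row, and products of the two give everything. -/
lemma matUnit_mem_of_isJacobi [DecidableEq T] (B : Subalgebra ℂ (MatProd n)) {X : MatProd n}
    (hX : X ∈ B) {t : T} (hJ : IsJacobi (X t)) {i₀ : Fin (n t)} (hi₀ : (i₀ : ℕ) = 0)
    (h : matUnit t i₀ i₀ ∈ B) (i j : Fin (n t)) : matUnit t i j ∈ B := by
  have hcol : ∀ m : ℕ, ∀ i : Fin (n t), (i : ℕ) = m → matUnit t i i₀ ∈ B := by
    intro m
    induction m using Nat.strong_induction_on with
    | _ m ih =>
      rintro i rfl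
      rcases Nat.eq_zero_or_pos i with h0 | h0
      · rwa [Fin.ext (h0.trans hi₀.symm)]
      · let k : Fin (n t) := ⟨i - 1, by omega⟩
        have hk : (i : ℕ) = k + 1 := by simp only [k]; omega
        have hsum := B.mul_mem hX (ih k (by omega) k rfl)
        rw [mul_matUnit] at hsum
        refine mem_of_sum_smul_mem (Subalgebra.toSubmodule B) _ _ i hsum
          (hJ.lower_ne_zero i k hk) fun l hl hc => ih l ?_ l rfl
        by_contra hlt
        exact hc (hJ.lower_eq_zero l k (by have := Fin.val_ne_of_ne hl; omega))
  have hrow : ∀ m : ℕ, ∀ i : Fin (n t), (i : ℕ) = m → matUnit t i₀ i ∈ B := by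
    intro m
    induction m using Nat.strong_induction_on with
    | _ m ih =>
      rintro i rfl
      rcases Nat.eq_zero_or_pos i with h0 | h0
      · rwa [Fin.ext (h0.trans hi₀.symm)]
      · let k : Fin (n t) := ⟨i - 1, by omega⟩
        have hk : (i : ℕ) = k + 1 := by simp only [k]; omega
        have hsum := B.mul_mem (ih k (by omega) k rfl) hX
        rw [matUnit_mul] at hsum
        refine mem_of_sum_smul_mem (Subalgebra.toSubmodule B) _ _ i hsum
          (hJ.upper_ne_zero k i hk) fun l hl hc => ih l ?_ l rfl
        by_contra hlt
        exact hc (hJ.upper_eq_zero k l (by have := Fin.val_ne_of_ne hl; omega))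
  rw [← matUnit_mul_matUnit t i i₀ j]
  exact B.mul_mem (hcol _ i rfl) (hrow _ j rfl)

lemma eq_top_of_matUnit_mem [Fintype T] [DecidableEq T] (B : Subalgebra ℂ (MatProd n))
    (h : ∀ t i j, matUnit t i j ∈ B) : B = ⊤ := by
  rw [eq_top_iff]
  intro M _
  have hM : M = ∑ t, ∑ i, ∑ j, M t i j • matUnit t i j := by
    conv_lhs => rw [← Finset.univ_sum_single M]
    refine Finset.sum_congr rfl fun t _ => ?_
    conv_lhs => rw [Matrix.matrix_eq_sum_single (M t)]
    simp only [matUnit, ← Pi.single_smul, single_sum_matProd, Matrix.smul_single, smul_eq_mul, mul_one]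
  rw [hM]
  exact sum_mem fun t _ => sum_mem fun i _ => sum_mem fun j _ => B.smul_mem (h t i j) _

/-- A subalgebra containing a family of Jacobi matrices contains all matrix units of a block if it
contains diagonal elements which separate the initial diagonal position of this block from all other
positions. -/
lemma matUnit_mem_of_separates [Fintype T] [DecidableEq T] (B : Subalgebra ℂ (MatProd n))
    {X : MatProd n} (hX : X ∈ B) {t : T} (hJ : IsJacobi (X t))
    (hsep : ∀ i₀ : Fin (n t), (i₀ : ℕ) = 0 → ∀ s ≠ (⟨t, i₀⟩ : Σ t, Fin (n t)),
      ∃ f, diagHom n f ∈ B ∧ f s ≠ f ⟨t, i₀⟩) (i j : Fin (n t)) : matUnit t i j ∈ B := by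
  refine matUnit_mem_of_isJacobi B hX hJ (i₀ := ⟨0, by have := i.2; omega⟩) rfl ?_ i j
  rw [← diagHom_single]
  exact single_mem_subalgebra (B.comap (diagHom n)) _ (hsep _ rfl)

end MatrixProducts

/-! ### Blocks of a string, and the case of odd dimension. -/

section Blocks

/-- The numerical data of an irreducible block of dimension `n`: it is spanned by the entries at
`p, p + 2, …, p + 2 (n - 1)` of a string of length `m + 1` whose entry at `p - 2` is `c₀` times the
entry at `p` plus `c₁` times the entry at `p + 2`. -/
structure Block where
  /-- The length of the string, minus one. -/
  m : ℕ
  /-- The initial position. -/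
  p : ℕ
  /-- The dimension of the block. -/
  n : ℕ
  /-- The first boundary coefficient. -/
  c₀ : ℤ
  /-- The second boundary coefficient. -/
  c₁ : ℕ

namespace Block

/-- The positions of the block are those positions of the string which are at least `p` and have
the same parity. -/
structure IsValid (b : Block) : Prop where
  p_le : b.p ≤ b.m
  lt_end : b.m < b.p + 2 * b.n
  end_le : b.p + 2 * b.n ≤ b.m + 2

/-- The weight of the string at the position of index `j`. -/
def weight (b : Block) (j : ℕ) : ℤ := b.m - 2 * (b.p + 2 * j)

/-- The entries below the diagonal. -/
noncomputable def down (b : Block) (j : ℕ) : ℂ :=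
  (((b.p : ℂ) + 2 * j + 1) * (b.p + 2 * j + 2)) / 2 +
    if j = 0 then (b.c₁ : ℂ) * ((((b.m : ℂ) - b.p + 1) * (b.m - b.p + 2)) / 2) else 0

/-- The entries above the diagonal. -/
noncomputable def up (b : Block) (j : ℕ) : ℂ :=
  (((b.m : ℂ) - b.p - 2 * j - 1) * (b.m - b.p - 2 * j)) / 2

/-- The entry at the initial diagonal position. -/
noncomputable def corner (b : Block) : ℂ :=
  (b.c₀ : ℂ) * ((((b.m : ℂ) - b.p + 1) * (b.m - b.p + 2)) / 2)

/-- The matrix by which `A2Jbar` acts on the block. -/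
noncomputable def mat (b : Block) : Matrix (Fin b.n) (Fin b.n) ℂ :=
  Matrix.of fun i j =>
    if (i : ℕ) = j + 1 then b.down j else if (j : ℕ) = i + 1 then b.up i
    else if (i : ℕ) = 0 ∧ (j : ℕ) = 0 then b.corner else 0

/-- The eigenvalues of `A2star` on the block, for the hypercube of dimension `D`. -/
noncomputable def starEig (D : ℕ) (b : Block) (j : ℕ) : ℂ := ((b.weight j : ℂ) ^ 2 - D) / 2

/-- The eigenvalues of `A2J` on the block, for the hypercube of dimension `D`. -/
noncomputable def sameEig (D : ℕ) (b : Block) (j : ℕ) : ℂ :=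
  ((b.m + ((b.m : ℂ) ^ 2 - (b.weight j : ℂ) ^ 2) / 2) - D) / 2

/-- The strings satisfying the boundary condition of the block. -/
def strings (Ω : Type*) [Fintype Ω] (b : Block) : Set (ℤ → StdModule Ω) :=
  {u | IsString b.m u ∧ u (b.p - 2) = (b.c₀ : ℂ) • u b.p + (b.c₁ : ℂ) • u (b.p + 2)}

/-- Twice each entry beside the diagonal is a positive natural number. The coefficient c₁ only adds
to the first entry below the diagonal, and c₀, which may be negative, enters the corner alone. -/
lemma isJacobi_mat {b : Block} (hb : b.IsValid) : IsJacobi b.mat where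
  lower_ne_zero i j h := by
    have hd : b.mat i j = b.down j := by simp [mat, h]
    obtain ⟨d, hm⟩ := Nat.exists_eq_add_of_le hb.p_le
    rw [hd, down, hm]
    have : ((b.p + 2 * j + 1) * (b.p + 2 * j + 2) +
        (if (j : ℕ) = 0 then b.c₁ * ((d + 1) * (d + 2)) else 0) : ℕ) ≠ 0 := by positivity
    intro h0
    refine this ?_
    rw [← Nat.cast_inj (R := ℂ)]
    split_ifs at h0 ⊢ <;> push_cast at h0 ⊢ <;> linear_combination 2 * h0
  upper_ne_zero i j h := by
    have hd : b.mat i j = b.up i := by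
      rw [mat, Matrix.of_apply, if_neg (by omega), if_pos h]
    have h1 := hb.end_le
    have h2 := j.2
    obtain ⟨d, hm⟩ : ∃ d, b.m = b.p + 2 * i + 2 + d := Nat.exists_eq_add_of_le (by omega)
    rw [hd, up, hm]
    have : ((d + 1) * (d + 2) : ℕ) ≠ 0 := by positivity
    intro h0
    refine this ?_
    rw [← Nat.cast_inj (R := ℂ)]
    push_cast at h0 ⊢
    linear_combination 2 * h0
  lower_eq_zero i j h := by
    simp only [mat, Matrix.of_apply]
    rw [if_neg (by omega), if_neg (by omega), if_neg (by omega)]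
  upper_eq_zero i j h := by
    simp only [mat, Matrix.of_apply]
    rw [if_neg (by omega), if_neg (by omega), if_neg (by omega)]

lemma sum_mat_smul {M : Type*} [AddCommGroup M] [Module ℂ M] (b : Block) (v : ℕ → M)
    (hv : v b.n = 0) (j : Fin b.n) :
    ∑ l, b.mat l j • v l =
      b.down j • v (j + 1) + if (j : ℕ) = 0 then b.corner • v 0 else b.up (j - 1) • v (j - 1) := by
  -- For j = 0 the truncated `j - 1` is 0, so the second summand then selects the corner.
  have h : ∀ l : Fin b.n, b.mat l j • v l =
      (if (l : ℕ) = j + 1 then b.down j • v l else 0) +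
        if (l : ℕ) = j - 1 then (if (j : ℕ) = 0 then b.corner • v l else b.up l • v l) else 0 := by
    intro l
    simp only [mat, Matrix.of_apply]
    split_ifs <;> first | omega | simp
  rw [Finset.sum_congr rfl fun l _ => h l, Fin.sum_univ_eq_sum_range (fun l =>
    (if l = j + 1 then b.down j • v l else 0) +
      if l = j - 1 then (if (j : ℕ) = 0 then b.corner • v l else b.up l • v l) else 0),
    Finset.sum_add_distrib, Finset.sum_ite_eq', Finset.sum_ite_eq']
  have hj := j.2
  congr 1
  · split_ifs with h1
    · rfl
    · rw [Finset.mem_range] at h1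
      rw [show (j : ℕ) + 1 = b.n by omega, hv, smul_zero]
  · rw [if_pos (Finset.mem_range.mpr (by omega))]
    split_ifs with h1
    · rw [h1]
    · rfl

lemma A2star_string {Ω : Type*} [Fintype Ω] {b : Block} {u : ℤ → StdModule Ω}
    (hu : IsString b.m u) (j : ℕ) :
    A2star Ω (u (b.p + 2 * j)) = b.starEig (Fintype.card Ω) j • u (b.p + 2 * j) := by
  rw [hu.star, starEig, weight]
  push_cast
  ring_nf

lemma A2J_string {Ω : Type*} [Fintype Ω] {b : Block} {u : ℤ → StdModule Ω}
    (hu : IsString b.m u) (j : ℕ) :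
    A2J Ω (u (b.p + 2 * j)) = b.sameEig (Fintype.card Ω) j • u (b.p + 2 * j) := by
  rw [hu.same, sameEig, weight]
  push_cast
  ring_nf

/-- The span is invariant at both ends: the boundary condition folds the entry at p - 2 back into
the block, and the entry at p + 2n is off the string. -/
lemma A2Jbar_string {Ω : Type*} [Fintype Ω] {b : Block} (hb : b.IsValid) {u : ℤ → StdModule Ω}
    (hu : u ∈ b.strings Ω) (j : Fin b.n) :
    A2Jbar Ω (u (b.p + 2 * (j : ℕ))) = ∑ l, b.mat l j • u (b.p + 2 * (l : ℕ)) := by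
  rw [b.sum_mat_smul (fun l => u (b.p + 2 * (l : ℕ)))
    (hu.1.eq_zero _ (by have := hb.lt_end; omega)), hu.1.diff]
  obtain ⟨j, hj⟩ := j
  rcases j with _ | j
  · simp only [if_true, down, corner, Nat.cast_zero, mul_zero, add_zero, zero_add, Nat.cast_one,
      mul_one, hu.2]
    push_cast
    module
  · simp only [Nat.add_one_ne_zero, if_false, down, up, Nat.add_sub_cancel]
    rw [show (b.p : ℤ) + 2 * ((j + 1 : ℕ) : ℤ) + 2 = b.p + 2 * ((j + 1 + 1 : ℕ) : ℤ) by
      push_cast; ring, show (b.p : ℤ) + 2 * ((j + 1 : ℕ) : ℤ) - 2 = b.p + 2 * (j : ℤ) by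
      push_cast; ring]
    push_cast
    module

/-- `A2star` gives the squared weight; `A2J` then gives m² + 2m, which is strictly increasing in m.
This is the Casimir eigenvalue in disguise. -/
lemma eq_of_eig_eq {D : ℕ} {b b' : Block} {j j' : ℕ} (h₁ : b.starEig D j = b'.starEig D j')
    (h₂ : b.sameEig D j = b'.sameEig D j') :
    b.m = b'.m ∧ b.weight j ^ 2 = b'.weight j' ^ 2 := by
  rw [starEig, starEig] at h₁
  rw [sameEig, sameEig] at h₂
  have hw : (b.weight j : ℂ) ^ 2 = (b'.weight j' : ℂ) ^ 2 := by linear_combination 2 * h₁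
  have hm : (2 * b.m + (b.m : ℂ) ^ 2) = 2 * b'.m + (b'.m : ℂ) ^ 2 := by
    linear_combination 4 * h₂ + hw
  have hm' : 2 * b.m + b.m ^ 2 = 2 * b'.m + b'.m ^ 2 := by exact_mod_cast hm
  refine ⟨?_, by exact_mod_cast hw⟩
  rcases lt_trichotomy b.m b'.m with h | h | h
  · nlinarith
  · exact h
  · nlinarith

end Block

/-- The criterion by which the algebra `R` is identified with the product of the matrix algebras of
a family of blocks. -/
lemma nonempty_R_algEquiv {Ω : Type*} [Fintype Ω] {T : Type*} (b : T → Block)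
    (hb : ∀ t, (b t).IsValid)
    (hinj : ∀ t, ∀ i < (b t).n, ∀ j < (b t).n, (b t).weight i ^ 2 = (b t).weight j ^ 2 → i = j)
    (hex : ∀ t, ∃ u ∈ (b t).strings Ω, ∀ j < (b t).n, u ((b t).p + 2 * j) ≠ 0)
    (hfaith : ∀ a : Module.End ℂ (StdModule Ω),
      (∀ t, ∀ u ∈ (b t).strings Ω, ∀ j < (b t).n, a (u ((b t).p + 2 * j)) = 0) → a = 0)
    (htop : ∀ B : Subalgebra ℂ (MatProd fun t => (b t).n), (fun t => (b t).mat) ∈ B →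
      diagHom _ (fun s => (b s.1).starEig (Fintype.card Ω) s.2) ∈ B →
      diagHom _ (fun s => (b s.1).sameEig (Fintype.card Ω) s.2) ∈ B → B = ⊤) :
    Nonempty (R Ω ≃ₐ[ℂ] MatProd fun t => (b t).n) := by
  let g : Fin 3 → Module.End ℂ (StdModule Ω) := ![A2J Ω, A2Jbar Ω, A2star Ω]
  let ρ : Fin 3 → MatProd fun t => (b t).n :=
    ![diagHom _ (fun s => (b s.1).sameEig (Fintype.card Ω) s.2), fun t => (b t).mat,
      diagHom _ (fun s => (b s.1).starEig (Fintype.card Ω) s.2)]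
  have hg : R Ω = Algebra.adjoin ℂ (Set.range g) := by
    simp only [R, g, Matrix.range_cons, Matrix.range_empty, Set.union_empty, Set.singleton_union]
  have hdiag : ∀ (f : (Σ t, Fin (b t).n) → ℂ) t (v : Fin (b t).n → StdModule Ω) j,
      ∑ l, diagHom (fun t => (b t).n) f t l j • v l = f ⟨t, j⟩ • v j := by
    intro f t v j
    simp [diagHom_apply, Matrix.diagonal_apply, ite_smul]
  rw [hg]
  refine nonempty_adjoin_algEquiv g ρ
    (fun t => {v | ∃ u ∈ (b t).strings Ω, v = fun j : Fin (b t).n => u ((b t).p + 2 * (j : ℕ))}) ?_ ?_ ?_ ?_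
  · rintro t _ ⟨u, hu, rfl⟩ i j
    fin_cases i
    · exact (Block.A2J_string hu.1 j).trans
        (hdiag (fun s => (b s.1).sameEig (Fintype.card Ω) s.2) t
          (fun l => u ((b t).p + 2 * (l : ℕ))) j).symm
    · exact Block.A2Jbar_string (hb t) hu j
    · exact (Block.A2star_string hu.1 j).trans
        (hdiag (fun s => (b s.1).starEig (Fintype.card Ω) s.2) t
          (fun l => u ((b t).p + 2 * (l : ℕ))) j).symm
  · intro t
    obtain ⟨u, hu, hu0⟩ := hex t
    refine ⟨_, ⟨u, hu, rfl⟩, Module.End.eigenvectors_linearIndependent' (A2star Ω)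
      (fun j : Fin (b t).n => (b t).starEig (Fintype.card Ω) j) (fun i j hij => ?_) _
      fun j => ⟨Module.End.mem_eigenspace_iff.mpr (Block.A2star_string hu.1 j), hu0 j j.2⟩⟩
    have hw : ((b t).weight i : ℂ) ^ 2 = ((b t).weight j : ℂ) ^ 2 := by
      simp only [Block.starEig] at hij
      linear_combination 2 * hij
    exact Fin.ext (hinj t i i.2 j j.2 (by exact_mod_cast hw))
  · exact fun a ha => hfaith a fun t u hu j hj => ha t _ ⟨u, hu, rfl⟩ ⟨j, hj⟩
  · exact htop _ (Algebra.subset_adjoin ⟨1, rfl⟩) (Algebra.subset_adjoin ⟨2, rfl⟩)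
      (Algebra.subset_adjoin ⟨0, rfl⟩)

/-- The blocks for a hypercube of odd dimension. -/
def oddBlock (k : ℕ) : Block := ⟨2 * k - 1, 0, k, 0, 0⟩

/-- Here m = 2k - 1 is odd, and the even positions alone form a block, since the odd ones are their
mirror images. Opposite weights never both occur among the even positions, as their difference 2m is
not divisible by 4; so squared weights separate the positions. -/
lemma nonempty_R_algEquiv_of_odd {Ω : Type*} [Fintype Ω] (hD : Odd (Fintype.card Ω)) :
    Nonempty (R Ω ≃ₐ[ℂ]
      MatProd fun k : Finset.Icc 1 ((Fintype.card Ω + 1) / 2) => (k : ℕ)) := by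
  classical
  obtain ⟨e, he⟩ := hD
  have hweight : ∀ k, 1 ≤ k → ∀ i < k, ∀ j < k,
      (oddBlock k).weight i ^ 2 = (oddBlock k).weight j ^ 2 → i = j := by
    intro k hk i _ j _ h
    simp only [oddBlock, Block.weight] at h
    rcases sq_eq_sq_iff_eq_or_eq_neg.mp h with h | h <;> omega
  have hstr : ∀ k, 1 ≤ k → ∀ u : ℤ → StdModule Ω, IsString (2 * k - 1) u →
      u ∈ (oddBlock k).strings Ω := by
    refine fun k hk u hu => ⟨hu, ?_⟩
    simp only [oddBlock]
    rw [hu.eq_zero _ (Or.inl (by norm_num))]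
    simp
  have hvalid : ∀ k ∈ Finset.Icc 1 ((Fintype.card Ω + 1) / 2), (oddBlock k).IsValid := by
    intro k hk
    rw [Finset.mem_Icc] at hk
    constructor <;> simp only [oddBlock] <;> omega
  refine nonempty_R_algEquiv (fun k : Finset.Icc 1 ((Fintype.card Ω + 1) / 2) => oddBlock k)
    (fun ⟨k, hk⟩ => hvalid k hk) (fun ⟨k, hk⟩ => hweight k (Finset.mem_Icc.mp hk).1)
    (fun ⟨k, hk⟩ => ?_) ?_ ?_
  · rw [Finset.mem_Icc] at hk
    obtain ⟨v, hv, hv0⟩ := exists_isLowest (Ω := Ω) (r := e + 1 - k) (by omega)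
    have hm : 2 * k - 1 + 2 * (e + 1 - k) = Fintype.card Ω := by omega
    refine ⟨ladder v, hstr k hk.1 _ (isString_ladder hm hv), fun j hj => ?_⟩
    simp only [oddBlock] at hj ⊢
    exact ladder_ne_zero hm hv hv0 (by omega) (by omega)
  · intro a ha
    refine eq_zero_of_ladder a fun r m v hm hv k hk => ?_
    have hu := isString_ladder hm hv
    obtain ⟨c, hc, rfl⟩ : ∃ c, 1 ≤ c ∧ m = 2 * c - 1 := ⟨(m + 1) / 2, by omega, by omega⟩
    have hkill : ∀ u ∈ (oddBlock c).strings Ω, ∀ j < c, a (u (2 * j)) = 0 := by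
      intro u hu j hj
      simpa [oddBlock] using ha ⟨c, Finset.mem_Icc.mpr ⟨hc, by omega⟩⟩ u hu j hj
    obtain ⟨j, hj | hj⟩ := Nat.even_or_odd' k
    · rw [hj]
      exact_mod_cast hkill _ (hstr c hc _ hu) j (by omega)
    -- The odd position 2j + 1 is the even position 2(c - 1 - j) of the reflected string.
    · have h := hkill _ (hstr c hc _ hu.reflect) (c - 1 - j) (by omega)
      rwa [show ((2 * c - 1 : ℕ) : ℤ) - 2 * ((c - 1 - j : ℕ) : ℤ) = k by omega] at h
  · intro B hX hS hJ
    refine eq_top_of_matUnit_mem B fun t => matUnit_mem_of_separates B hX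
      (Block.isJacobi_mat ?_) fun i₀ _ s hs => ?_
    · obtain ⟨k, hk⟩ := t
      exact hvalid k hk
    · by_contra! hall
      refine hs ?_
      obtain ⟨h1, h2⟩ := Block.eq_of_eig_eq (hall _ hS) (hall _ hJ)
      obtain ⟨⟨k', hk'⟩, j'⟩ := s
      obtain ⟨k, hk⟩ := t
      have hk1 := (Finset.mem_Icc.mp hk).1
      have hk1' := (Finset.mem_Icc.mp hk').1
      obtain rfl : k' = k := by
        simp only [oddBlock] at h1
        omega
      rw [Fin.ext (hweight k' hk1 j' j'.2 i₀ i₀.2 h2)]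

end Blocks

/-! ### Symmetric and antisymmetric sectors in even dimension. -/

section EvenBlocks

/-- The parameters of a block for a hypercube of even dimension: half the length of the string, the
distance of the first position from the middle, the behaviour under reflection, and the
dimension. -/
structure Sector where
  /-- Half the length of the string. -/
  half : ℕ
  /-- The distance of the first position from the middle of the string. -/
  shift : ℕ
  /-- The sign by which the reflection acts. -/
  sign : ℤ
  /-- The dimension. -/
  dim : ℕ

namespace Sector

/-- The block of a sector. -/
def block (σ : Sector) : Block where
  m := 2 * σ.half
  p := σ.half + σ.shift
  n := σ.dim
  -- For shift 1 the position p - 2 mirrors p, giving the sign. For shift 0 it mirrors p + 2, and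
  -- the sign is 1. For shift 2 it is the middle, where an antisymmetric string vanishes.
  c₀ := if σ.shift = 1 then σ.sign else 0
  c₁ := if σ.shift = 0 then 1 else 0

/-- The sectors which occur. -/
structure IsValid (σ : Sector) : Prop where
  -- At even distances from the middle, the symmetric vectors start at the middle itself, while the
  -- antisymmetric ones vanish there and start at distance 2. At odd distances both signs start at
  -- 1.
  kind : (σ.shift = 0 ∧ σ.sign = 1) ∨ (σ.shift = 1 ∧ (σ.sign = 1 ∨ σ.sign = -1)) ∨
    (σ.shift = 2 ∧ σ.sign = -1)
  shift_le : σ.shift ≤ σ.half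
  dim_eq : σ.dim = (σ.half - σ.shift) / 2 + 1

lemma IsValid.block_isValid {σ : Sector} (hσ : σ.IsValid) : σ.block.IsValid := by
  have h₁ := hσ.shift_le
  have h₂ := hσ.dim_eq
  constructor <;> simp only [block] <;> omega

lemma weight_sq (σ : Sector) (j : ℕ) :
    σ.block.weight j ^ 2 = 4 * ((σ.shift + 2 * j : ℕ) : ℤ) ^ 2 := by
  simp only [block, Block.weight]
  push_cast
  ring

lemma weight_sq_eq_iff (σ τ : Sector) (i j : ℕ) :
    σ.block.weight i ^ 2 = τ.block.weight j ^ 2 ↔ σ.shift + 2 * i = τ.shift + 2 * j := by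
  rw [weight_sq, weight_sq, mul_right_inj' (by norm_num), sq_eq_sq₀ (by positivity) (by positivity),
    Nat.cast_inj]

lemma mem_strings {Ω : Type*} [Fintype Ω] {σ : Sector} (hσ : σ.IsValid) {u : ℤ → StdModule Ω}
    (hu : IsString (2 * σ.half) u) :
    (fun k : ℤ => u k + (σ.sign : ℂ) • u ((2 * σ.half : ℕ) - k)) ∈ σ.block.strings Ω := by
  refine ⟨hu.add_smul hu.reflect _, ?_⟩
  obtain ⟨p, s, g, n⟩ := σ
  rcases hσ.kind with ⟨hs, hg⟩ | ⟨hs, hg | hg⟩ | ⟨hs, hg⟩ <;> dsimp only at hs hg <;> subst hs hg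
  · simp only [block]
    norm_num
    rw [show 2 * (p : ℤ) - (p - 2) = p + 2 by ring, show 2 * (p : ℤ) - (p + 2) = p - 2 by ring,
      add_comm]
  · simp only [block]
    norm_num
    rw [show (p : ℤ) + 1 - 2 = p - 1 by ring, show 2 * (p : ℤ) - (p - 1) = p + 1 by ring,
      show 2 * (p : ℤ) - (p + 1) = p - 1 by ring, add_comm]
  · simp only [block]
    norm_num
    rw [show (p : ℤ) + 1 - 2 = p - 1 by ring, show 2 * (p : ℤ) - (p - 1) = p + 1 by ring,
      show 2 * (p : ℤ) - (p + 1) = p - 1 by ring, add_comm]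
  · simp only [block]
    norm_num
    rw [show 2 * (p : ℤ) - p = p by ring, add_neg_cancel]

end Sector

variable {T : Type*} {σ : T → Sector}

/-- The diagonal element which on the sectors of shift one is supported at the initial position,
with the corner entry of the matrix of `A2Jbar` as its value, belongs to the algebra. -/
lemma diagHom_corner_mem [Fintype T] (D : ℕ)
    (B : Subalgebra ℂ (MatProd fun t => (σ t).block.n))
    (hX : (fun t => (σ t).block.mat) ∈ B)
    (hS : diagHom _ (fun s => (σ s.1).block.starEig D s.2) ∈ B) :
    diagHom _ (fun s => if (σ s.1).shift + 2 * (s.2 : ℕ) = 1 then (σ s.1).block.corner else 0)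
      ∈ B := by
  -- Distance one from the middle means squared weight 4, an eigenspace of `A2star`. Each block has
  -- at most one such position, so compressing `A2Jbar` by this projection leaves only the corner.
  have hP : diagHom _ (fun s => if (σ s.1).shift + 2 * (s.2 : ℕ) = 1 then (1 : ℂ) else 0) ∈ B := by
    have h := indicator_mem_subalgebra (B.comap (diagHom _)) hS ((4 - D) / 2)
    have hiff : ∀ s : Σ t, Fin (σ t).block.n,
        (σ s.1).block.starEig D s.2 = (4 - D) / 2 ↔ (σ s.1).shift + 2 * (s.2 : ℕ) = 1 := by
      intro s
      have h4 : (σ s.1).block.starEig D s.2 = (4 - D) / 2 ↔ (σ s.1).block.weight s.2 ^ 2 = 4 := by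
        rw [Block.starEig, div_left_inj' two_ne_zero, sub_left_inj]
        exact_mod_cast Iff.rfl
      rw [h4, Sector.weight_sq]
      generalize (σ s.1).shift + 2 * (s.2 : ℕ) = e
      constructor
      · intro h
        have : ((e : ℤ)) ^ 2 = 1 := by omega
        have : e ^ 2 = 1 := by exact_mod_cast this
        simpa using this
      · rintro rfl
        norm_num
    simp only [hiff] at h
    exact h
  have h := B.mul_mem (B.mul_mem hP hX) hP
  convert h using 1
  funext t
  ext i j
  simp only [Pi.mul_apply, diagHom_apply, Matrix.mul_diagonal, Matrix.diagonal_mul,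
    Matrix.diagonal_apply, Block.mat, Matrix.of_apply]
  by_cases hij : i = j
  · subst hij
    by_cases hi : (σ t).shift + 2 * (i : ℕ) = 1
    · have h0 : (i : ℕ) = 0 := by omega
      simp [h0, show (σ t).shift = 1 by omega]
    · simp [hi]
  · rw [if_neg hij]
    by_cases hi : (σ t).shift + 2 * (i : ℕ) = 1
    · have : ¬ (σ t).shift + 2 * (j : ℕ) = 1 := fun h => hij (Fin.ext (by omega))
      simp [this]
    · simp [hi]

/-- The sum of the unit matrices of the blocks in a set belongs to an algebra which contains all
matrix units of these blocks. -/
lemma diagHom_indicator_mem [Fintype T] [DecidableEq T] {n : T → ℕ} (B : Subalgebra ℂ (MatProd n))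
    (p : T → Prop) [DecidablePred p] (h : ∀ t, p t → ∀ i, matUnit t i i ∈ B) :
    diagHom n (fun s => if p s.1 then 1 else 0) ∈ B := by
  have hsum : (fun s : Σ t, Fin (n t) => if p s.1 then (1 : ℂ) else 0) =
      ∑ s : Σ t, Fin (n t), if p s.1 then Pi.single s 1 else 0 := by
    funext s
    rw [Finset.sum_apply, Finset.sum_eq_single s]
    · split_ifs <;> simp
    · intro s' _ hs'
      split_ifs
      · exact Pi.single_eq_of_ne hs'.symm _
      · rfl
    · simp
  rw [hsum, map_sum]
  refine B.sum_mem fun s _ => ?_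
  split_ifs with hs
  · rw [diagHom_single]
    exact h _ hs _
  · rw [map_zero]
    exact B.zero_mem

/-- The diagonal generators determine the half-length and the distance from the middle. Distance 0
occurs only in a sector of shift 0, so those blocks are obtained first. Their unit element then
separates the start of a shift 2 sector from the second position of the shift 0 sector, and the
corner of `A2Jbar` separates the two signs of shift 1. -/
lemma eq_top_of_sectors [Fintype T] (D : ℕ) (hσ : ∀ t, (σ t).IsValid)
    (hinj : ∀ t t', (σ t).half = (σ t').half → (σ t).shift = (σ t').shift →
      (σ t).sign = (σ t').sign → t = t')
    (B : Subalgebra ℂ (MatProd fun t => (σ t).block.n))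
    (hX : (fun t => (σ t).block.mat) ∈ B)
    (hS : diagHom _ (fun s => (σ s.1).block.starEig D s.2) ∈ B)
    (hJ : diagHom _ (fun s => (σ s.1).block.sameEig D s.2) ∈ B) : B = ⊤ := by
  classical
  have hsep : ∀ (s : Σ t, Fin (σ t).block.n) (t : T) (i : Fin (σ t).block.n), (i : ℕ) = 0 →
      (∀ f, diagHom (fun t => (σ t).block.n) f ∈ B → f s = f ⟨t, i⟩) →
      (σ s.1).half = (σ t).half ∧ (σ s.1).shift + 2 * (s.2 : ℕ) = (σ t).shift := by
    intro s t i hi h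
    obtain ⟨h1, h2⟩ := Block.eq_of_eig_eq (h _ hS) (h _ hJ)
    rw [Sector.weight_sq_eq_iff] at h2
    simp only [Sector.block] at h1
    simp only [hi] at h2
    exact ⟨by omega, h2⟩
  have heq : ∀ (s : Σ t, Fin (σ t).block.n) (t : T) (i : Fin (σ t).block.n), s.1 = t →
      (s.2 : ℕ) = i → s = ⟨t, i⟩ := by
    rintro ⟨t', i'⟩ t i rfl h
    exact congrArg (Sigma.mk t') (Fin.ext h)
  have hzero : ∀ t, (σ t).shift = 0 → ∀ i j, matUnit t i j ∈ B := by
    refine fun t ht => matUnit_mem_of_separates B hX (Block.isJacobi_mat (hσ t).block_isValid)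
      fun i hi s hs => ?_
    by_contra! h
    obtain ⟨h1, h2⟩ := hsep s t i hi h
    have k1 := (hσ t).kind
    have k2 := (hσ s.1).kind
    exact hs (heq s t i (hinj _ _ h1 (by omega) (by omega)) (by omega))
  have hI := diagHom_indicator_mem B (fun t => (σ t).shift = 0) fun t ht i => hzero t ht i i
  have hC := diagHom_corner_mem D B hX hS
  refine eq_top_of_matUnit_mem B fun t => matUnit_mem_of_separates B hX
    (Block.isJacobi_mat (hσ t).block_isValid) fun i hi s hs => ?_
  by_contra! h
  obtain ⟨h1, h2⟩ := hsep s t i hi h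
  have k1 := (hσ t).kind
  have k2 := (hσ s.1).kind
  have h3 : (σ s.1).shift = 0 ↔ (σ t).shift = 0 := by
    have := h _ hI
    dsimp only at this
    split_ifs at this with a b b <;> simp_all
  have h4 : (σ s.1).shift = (σ t).shift ∧ (s.2 : ℕ) = 0 := by omega
  refine hs (heq s t i (hinj _ _ h1 h4.1 ?_) (by omega))
  rcases k1 with k1 | k1 | k1
  · omega
  -- For equal half-length h the corners are the signs times h(h + 1)/2, which is nonzero because
  -- shift 1 requires h ≥ 1.
  · have h5 := h _ hC
    have hp := (hσ t).shift_le
    simp only [k1.1, h4.2, hi, if_true, mul_zero, add_zero, Block.corner, Sector.block, h1, h4.1] at h5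
    have h6 := mul_right_cancel₀ (b := ((((2 * (σ t).half : ℕ) : ℂ) - ((σ t).half + 1 : ℕ) + 1) *
      (((2 * (σ t).half : ℕ) : ℂ) - ((σ t).half + 1 : ℕ) + 2)) / 2) ?_ h5
    · exact_mod_cast h6
    · obtain ⟨d, hd⟩ : ∃ d, (σ t).half = d + 1 := ⟨(σ t).half - 1, by omega⟩
      rw [hd]
      have : (((d + 1) * (d + 2) : ℕ) : ℂ) ≠ 0 := by
        rw [Nat.cast_ne_zero]
        positivity
      refine div_ne_zero (fun h0 => this ?_) two_ne_zero
      push_cast at h0 ⊢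
      linear_combination h0
  · omega

lemma nonempty_R_algEquiv_of_even {Ω : Type*} [Fintype Ω] [Fintype T] {e : ℕ}
    (hD : Fintype.card Ω = 2 * e) (hσ : ∀ t, (σ t).IsValid) (hle : ∀ t, (σ t).half ≤ e)
    (hinj : ∀ t t', (σ t).half = (σ t').half → (σ t).shift = (σ t').shift →
      (σ t).sign = (σ t').sign → t = t')
    (hsurj : ∀ τ : Sector, τ.IsValid → τ.half ≤ e → ∃ t, σ t = τ) :
    Nonempty (R Ω ≃ₐ[ℂ] MatProd fun t => (σ t).dim) := by
  classical
  refine nonempty_R_algEquiv (fun t => (σ t).block) (fun t => (hσ t).block_isValid)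
    (fun t i _ j _ h => ?_) (fun t => ?_) (fun a ha => ?_) (eq_top_of_sectors _ hσ hinj)
  · rw [Sector.weight_sq_eq_iff] at h
    omega
  · have h1 := hle t
    obtain ⟨v, hv, hv0⟩ := exists_isLowest (Ω := Ω) (r := e - (σ t).half) (by omega)
    have hm : 2 * (σ t).half + 2 * (e - (σ t).half) = Fintype.card Ω := by omega
    refine ⟨_, Sector.mem_strings (hσ t) (isString_ladder hm hv), fun j hj => ?_⟩
    have h2 := (hσ t).block_isValid.end_le
    simp only [Sector.block] at hj h2 ⊢
    have hne : ladder v (((σ t).half + (σ t).shift : ℕ) + 2 * (j : ℤ)) ≠ 0 :=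
      ladder_ne_zero hm hv hv0 (by omega) (by omega)
    -- A position fixed by reflection is the middle; it occurs only with sign 1 and gives twice a
    -- ladder entry. Elsewhere the two terms have different levels and cannot cancel.
    by_cases hmid : ((σ t).half + (σ t).shift : ℕ) + 2 * (j : ℤ) =
      (2 * (σ t).half : ℕ) - (((σ t).half + (σ t).shift : ℕ) + 2 * (j : ℤ))
    · have hsgn : (σ t).sign = 1 := by
        have := (hσ t).kind
        omega
      rw [← hmid, hsgn, Int.cast_one, one_smul, ← two_smul ℂ]
      exact smul_ne_zero two_ne_zero hne
    · exact ladder_add_smul_ne_zero hv.1 hmid hne _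
  · refine eq_zero_of_ladder a fun r m v hm hv => ?_
    obtain ⟨p, rfl⟩ : ∃ p, m = 2 * p := ⟨m / 2, by omega⟩
    have hu := isString_ladder hm hv
    have hkill : ∀ s g, (⟨p, s, g, (p - s) / 2 + 1⟩ : Sector).IsValid → ∀ j, s + 2 * j ≤ p →
        a (ladder v ((p + s : ℕ) + 2 * (j : ℤ)) +
          (g : ℂ) • ladder v ((2 * p : ℕ) - ((p + s : ℕ) + 2 * (j : ℤ)))) = 0 := by
      intro s g hτ j hj
      obtain ⟨t, ht⟩ := hsurj _ hτ (by dsimp only; omega)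
      have h := ha t
      rw [ht] at h
      exact h _ (Sector.mem_strings hτ hu) j (by simp only [Sector.block]; omega)
    have hsym : ∀ d ≤ p, a (ladder v (p + d : ℕ) + ladder v (p - d)) = 0 := by
      intro d hd
      obtain ⟨j, hj | hj⟩ := Nat.even_or_odd' d
      · have h := hkill 0 1 ⟨by simp, by simp, rfl⟩ j (by omega)
        rw [Int.cast_one, one_smul] at h
        convert h using 4 <;> push_cast <;> omega
      · have h := hkill 1 1 ⟨by simp, by dsimp only; omega, rfl⟩ j (by omega)
        rw [Int.cast_one, one_smul] at h
        convert h using 4 <;> push_cast <;> omega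
    have hanti : ∀ d ≤ p, a (ladder v (p + d : ℕ) - ladder v (p - d)) = 0 := by
      intro d hd
      rcases Nat.eq_zero_or_pos d with rfl | hd0
      · simp
      obtain ⟨j, hj | hj⟩ := Nat.even_or_odd' d
      · have h := hkill 2 (-1) ⟨by simp, by dsimp only; omega, rfl⟩ (j - 1) (by omega)
        rw [Int.cast_neg, Int.cast_one, neg_one_smul, ← sub_eq_add_neg] at h
        convert h using 4 <;> push_cast <;> omega
      · have h := hkill 1 (-1) ⟨by simp, by dsimp only; omega, rfl⟩ j (by omega)
        rw [Int.cast_neg, Int.cast_one, neg_one_smul, ← sub_eq_add_neg] at h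
        convert h using 4 <;> push_cast <;> omega
    -- The symmetric and antisymmetric combinations together recover both mirror entries.
    have hboth : ∀ d ≤ p, a (ladder v (p + d : ℕ)) = 0 ∧ a (ladder v (p - d)) = 0 := by
      intro d hd
      have h1 := hsym d hd
      have h2 := hanti d hd
      rw [map_add] at h1
      rw [map_sub, sub_eq_zero] at h2
      rw [h2, ← two_smul ℂ, smul_eq_zero] at h1
      have h3 := h1.resolve_left two_ne_zero
      exact ⟨h2.trans h3, h3⟩
    intro k hk
    rcases le_total p k with hpk | hpk
    · have h := (hboth (k - p) (by omega)).1
      rwa [Nat.add_sub_cancel' hpk] at h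
    · have h := (hboth (p - k) (by omega)).2
      rwa [Nat.cast_sub hpk, sub_sub_cancel] at h

end EvenBlocks

/-! ### Counting sectors by dimension. -/

section Classification

/-- The sectors of dimension `k ≥ 1`, ordered by the length of the string. -/
def sectorOf (k : ℕ) (θ : Fin 8) : Sector where
  -- These solve (half - shift)/2 + 1 = k for each of the four kinds, with two solutions apiece
  -- because of the rounding. As the list is nondecreasing, a bound on the half-length keeps an
  -- initial segment.
  half := ![2 * k - 2, 2 * k - 1, 2 * k - 1, 2 * k - 1, 2 * k, 2 * k, 2 * k, 2 * k + 1] θ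
  shift := ![0, 0, 1, 1, 1, 1, 2, 2] θ
  sign := ![1, 1, 1, -1, 1, -1, -1, -1] θ
  dim := k

lemma sectorOf_isValid {k : ℕ} (hk : 1 ≤ k) (θ : Fin 8) : (sectorOf k θ).IsValid := by
  constructor <;> fin_cases θ <;> simp [sectorOf] <;> omega

lemma sectorOf_injective {k k' : ℕ} (hk : 1 ≤ k) (hk' : 1 ≤ k') {θ θ' : Fin 8}
    (h₁ : (sectorOf k θ).half = (sectorOf k' θ').half)
    (h₂ : (sectorOf k θ).shift = (sectorOf k' θ').shift)
    (h₃ : (sectorOf k θ).sign = (sectorOf k' θ').sign) : k = k' ∧ θ = θ' := by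
  fin_cases θ <;> fin_cases θ' <;> simp [sectorOf] at h₁ h₂ h₃ ⊢ <;> omega

lemma exists_sectorOf_eq {τ : Sector} (hτ : τ.IsValid) : ∃ θ, sectorOf τ.dim θ = τ := by
  obtain ⟨p, s, g, n⟩ := τ
  obtain ⟨h₁, h₂, h₃⟩ := hτ
  dsimp only at h₁ h₂ h₃ ⊢
  have key : ∀ θ : Fin 8, (sectorOf n θ).half = p → (sectorOf n θ).shift = s →
      (sectorOf n θ).sign = g → ∃ θ, sectorOf n θ = ⟨p, s, g, n⟩ := by
    rintro θ rfl rfl rfl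
    exact ⟨θ, rfl⟩
  rcases h₁ with ⟨rfl, rfl⟩ | ⟨rfl, rfl | rfl⟩ | ⟨rfl, rfl⟩ <;>
    obtain ⟨q, rfl | rfl⟩ := Nat.even_or_odd' p
  · exact key 0 (by simp [sectorOf]; omega) rfl rfl
  · exact key 1 (by simp [sectorOf]; omega) rfl rfl
  · exact key 4 (by simp [sectorOf]; omega) rfl rfl
  · exact key 2 (by simp [sectorOf]; omega) rfl rfl
  · exact key 5 (by simp [sectorOf]; omega) rfl rfl
  · exact key 3 (by simp [sectorOf]; omega) rfl rfl
  · exact key 6 (by simp [sectorOf]; omega) rfl rfl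
  · exact key 7 (by simp [sectorOf]; omega) rfl rfl

lemma nonempty_R_algEquiv_of_index {Ω : Type*} [Fintype Ω] {T : Type*} [Fintype T] {e : ℕ}
    (hD : Fintype.card Ω = 2 * e) (n : T → ℕ) (θ : T → Fin 8) (hn : ∀ t, 1 ≤ n t)
    (hle : ∀ t, (sectorOf (n t) (θ t)).half ≤ e)
    (hinj : ∀ t t', n t = n t' → θ t = θ t' → t = t')
    (hsurj : ∀ k ϑ, 1 ≤ k → (sectorOf k ϑ).half ≤ e → ∃ t, n t = k ∧ θ t = ϑ) :
    Nonempty (R Ω ≃ₐ[ℂ] MatProd n) := by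
  refine nonempty_R_algEquiv_of_even (σ := fun t => sectorOf (n t) (θ t)) hD
    (fun t => sectorOf_isValid (hn t) _) hle (fun t t' h₁ h₂ h₃ => ?_) fun τ hτ hτe => ?_
  · obtain ⟨h, h'⟩ := sectorOf_injective (hn t) (hn t') h₁ h₂ h₃
    exact hinj t t' h h'
  · obtain ⟨ϑ, hϑ⟩ := exists_sectorOf_eq hτ
    obtain ⟨t, ht, ht'⟩ := hsurj τ.dim ϑ (by rw [hτ.dim_eq]; omega) (by rwa [hϑ])
    exact ⟨t, by rw [ht, ht', hϑ]⟩

/-- The index set of the blocks in dimension `4 J + 2`. -/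
abbrev IndexTwo (J : ℕ) : Type := Fin 4 ⊕ (Fin 8 × Finset.Icc 1 J)

/-- The dimensions of the blocks in dimension `4 J + 2`. -/
def dimTwo (d J : ℕ) : IndexTwo J → ℕ :=
  Sum.elim (fun _ => d) fun t => t.2

/-- The index set of the blocks in dimension `4 J`. -/
abbrev IndexZero (J : ℕ) : Type := Unit ⊕ (Fin 7 ⊕ (Fin 8 × Finset.Icc 1 (J - 1)))

/-- The dimensions of the blocks in dimension `4 J`. -/
def dimZero (J : ℕ) : IndexZero J → ℕ :=
  Sum.elim (fun _ => J + 1) (Sum.elim (fun _ => J) fun t => t.2)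

/-- With half-length at most 2J + 1, all eight sectors of each dimension up to J fit, then the first
four of dimension J + 1, and none beyond. -/
lemma nonempty_R_algEquiv_two {Ω : Type*} [Fintype Ω] {J : ℕ}
    (hD : Fintype.card Ω = 4 * J + 2) :
    Nonempty (R Ω ≃ₐ[ℂ] MatProd (dimTwo (J + 1) J)) := by
  refine nonempty_R_algEquiv_of_index (e := 2 * J + 1) (by omega) _
    (Sum.elim (Fin.castLE (by norm_num)) Prod.fst) ?_ ?_ ?_ ?_
  · rintro (i | ⟨ϑ, k, hk⟩)
    · simp [dimTwo]
    · exact (Finset.mem_Icc.mp hk).1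
  · rintro (i | ⟨ϑ, k, hk⟩)
    · fin_cases i <;> simp [sectorOf, dimTwo] <;> omega
    · have := Finset.mem_Icc.mp hk
      fin_cases ϑ <;> simp [sectorOf, dimTwo] <;> omega
  · rintro (i | ⟨ϑ, k, hk⟩) (i' | ⟨ϑ', k', hk'⟩) h h'
    · simpa [Fin.ext_iff] using h'
    · have := (Finset.mem_Icc.mp hk').2
      simp only [dimTwo, Sum.elim_inl, Sum.elim_inr] at h
      omega
    · have := (Finset.mem_Icc.mp hk).2
      simp only [dimTwo, Sum.elim_inl, Sum.elim_inr] at h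
      omega
    · simp only [dimTwo, Sum.elim_inr] at h h'
      subst h h'
      rfl
  · intro k ϑ hk hle
    rcases le_or_gt k J with hkJ | hkJ
    · exact ⟨Sum.inr (ϑ, ⟨k, Finset.mem_Icc.mpr ⟨hk, hkJ⟩⟩), rfl, rfl⟩
    · have h : k = J + 1 ∧ (ϑ : ℕ) < 4 := by
        fin_cases ϑ <;> simp [sectorOf] at hle ⊢ <;> omega
      exact ⟨Sum.inl ⟨ϑ, h.2⟩, h.1.symm, rfl⟩

/-- With half-length at most 2J, dimension J loses only its last sector, of half-length 2J + 1, and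
dimension J + 1 keeps only its first, of half-length 2J. -/
lemma nonempty_R_algEquiv_zero {Ω : Type*} [Fintype Ω] {J : ℕ} (hJ : 1 ≤ J)
    (hD : Fintype.card Ω = 4 * J) : Nonempty (R Ω ≃ₐ[ℂ] MatProd (dimZero J)) := by
  refine nonempty_R_algEquiv_of_index (e := 2 * J) (by omega) _
    (Sum.elim (fun _ => 0) (Sum.elim (Fin.castLE (by norm_num)) Prod.fst)) ?_ ?_ ?_ ?_
  · rintro (_ | i | ⟨ϑ, k, hk⟩)
    · simp [dimZero]
    · exact hJ
    · exact (Finset.mem_Icc.mp hk).1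
  · rintro (_ | i | ⟨ϑ, k, hk⟩)
    · simp [sectorOf, dimZero]
      omega
    · fin_cases i <;> simp [sectorOf, dimZero]
    · have := Finset.mem_Icc.mp hk
      fin_cases ϑ <;> simp [sectorOf, dimZero] <;> omega
  · have hlt : ∀ k ∈ Finset.Icc 1 (J - 1), k < J := fun k hk => by
      have := Finset.mem_Icc.mp hk
      omega
    rintro (_ | i | ⟨ϑ, k, hk⟩) (_ | i' | ⟨ϑ', k', hk'⟩) h h' <;>
      simp only [dimZero, Sum.elim_inl, Sum.elim_inr] at h h'
    · rfl
    · omega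
    · have := hlt k' hk'
      omega
    · omega
    · simpa [Fin.ext_iff] using h'
    · have := hlt k' hk'
      omega
    · have := hlt k hk
      omega
    · have := hlt k hk
      omega
    · subst h h'
      rfl
  · intro k ϑ hk hle
    rcases lt_trichotomy k J with hkJ | rfl | hkJ
    · exact ⟨Sum.inr (Sum.inr (ϑ, ⟨k, Finset.mem_Icc.mpr ⟨hk, by omega⟩⟩)), rfl, rfl⟩
    · have h : (ϑ : ℕ) < 7 := by
        fin_cases ϑ <;> simp [sectorOf] at hle ⊢
      exact ⟨Sum.inr (Sum.inl ⟨ϑ, h⟩), rfl, rfl⟩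
    · have h : k = J + 1 ∧ ϑ = 0 := by
        fin_cases ϑ <;> simp [sectorOf] at hle ⊢ <;> omega
      exact ⟨Sum.inl (), h.1.symm, h.2.symm⟩

/-- A product of matrix algebras as a product of endomorphism algebras. -/
noncomputable def matProdEquiv {T : Type*} (n : T → ℕ) : MatProd n ≃ₐ[ℂ] ((t : T) → MatEnd (n t)) :=
  AlgEquiv.piCongrRight fun _ => Matrix.toLinAlgEquiv'

/-- The product over `IndexTwo J`, written as an iterated product. -/
def piIndexTwoEquiv {J : ℕ} (F : IndexTwo J → Type*) [∀ t, Semiring (F t)] [∀ t, Algebra ℂ (F t)] :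
    ((t : IndexTwo J) → F t) ≃ₐ[ℂ] ((i : Fin 4) → F (Sum.inl i)) ×
      ((ϑ : Fin 8) → (k : Finset.Icc 1 J) → F (Sum.inr (ϑ, k))) where
  toFun f := (fun i => f (Sum.inl i), fun ϑ k => f (Sum.inr (ϑ, k)))
  invFun p := fun
    | Sum.inl i => p.1 i
    | Sum.inr (ϑ, k) => p.2 ϑ k
  left_inv f := by
    funext t
    rcases t with i | ⟨ϑ, k⟩ <;> rfl
  right_inv _ := rfl
  map_mul' _ _ := rfl
  map_add' _ _ := rfl
  commutes' _ := rfl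

/-- The product over `IndexZero J`, written as an iterated product. -/
def piIndexZeroEquiv {J : ℕ} (F : IndexZero J → Type*) [∀ t, Semiring (F t)]
    [∀ t, Algebra ℂ (F t)] :
    ((t : IndexZero J) → F t) ≃ₐ[ℂ] F (Sum.inl ()) × ((i : Fin 7) → F (Sum.inr (Sum.inl i))) ×
      ((ϑ : Fin 8) → (k : Finset.Icc 1 (J - 1)) → F (Sum.inr (Sum.inr (ϑ, k)))) where
  toFun f := (f (Sum.inl ()), fun i => f (Sum.inr (Sum.inl i)),
    fun ϑ k => f (Sum.inr (Sum.inr (ϑ, k))))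
  invFun p := fun
    | Sum.inl () => p.1
    | Sum.inr (Sum.inl i) => p.2.1 i
    | Sum.inr (Sum.inr (ϑ, k)) => p.2.2 ϑ k
  left_inv f := by
    funext t
    rcases t with i | i | ⟨ϑ, k⟩ <;> rfl
  right_inv _ := rfl
  map_mul' _ _ := rfl
  map_add' _ _ := rfl
  commutes' _ := rfl

lemma finrank_matProd {T : Type*} [Fintype T] (n : T → ℕ) :
    Module.finrank ℂ (MatProd n) = ∑ t, n t ^ 2 := by
  rw [Module.finrank_pi_fintype]
  refine Finset.sum_congr rfl fun t _ => ?_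
  rw [Module.finrank_matrix, Module.finrank_self, Fintype.card_fin, mul_one, pow_two]

lemma six_mul_sum_sq (m : ℕ) :
    6 * ∑ k : Finset.Icc 1 m, (k : ℕ) ^ 2 = m * (m + 1) * (2 * m + 1) := by
  rw [Finset.sum_coe_sort (Finset.Icc 1 m) fun k => k ^ 2]
  induction m with
  | zero => simp
  | succ m ih =>
    rw [Finset.sum_Icc_succ_top (by omega), mul_add, ih]
    ring

lemma six_mul_choose_three (m : ℕ) : 6 * (m + 2).choose 3 = m * (m + 1) * (m + 2) := by
  induction m with
  | zero => rfl
  | succ m ih =>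
    have h := Nat.choose_succ_succ' (m + 2) 2
    have h3 : 2 * (m + 2).choose 2 = (m + 1) * (m + 2) := by
      rw [Nat.choose_two_right, Nat.mul_div_cancel' (Nat.even_mul_pred_self _).two_dvd]
      rw [show m + 2 - 1 = m + 1 by omega]
      ring
    rw [show m + 1 + 2 = m + 2 + 1 by ring, h, mul_add, ih]
    linarith

end Classification
end HypercubeAlgebra

/-! ### The three cases and the dimension. -/

theorem mainTheorem9 (Ω : Type*) [Fintype Ω] (D : ℕ) (hcard : Fintype.card Ω = D) (hD : 2 ≤ D) :
    ((Odd D →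
        Nonempty (HypercubeAlgebra.R Ω ≃ₐ[ℂ] HypercubeAlgebra.SumEnd ((D + 1) / 2))) ∧
      (D % 4 = 2 →
        Nonempty (HypercubeAlgebra.R Ω ≃ₐ[ℂ]
          ((Fin 4 → HypercubeAlgebra.MatEnd ((D + 2) / 4)) ×
            (Fin 8 → HypercubeAlgebra.SumEnd ((D - 2) / 4))))) ∧
      (D % 4 = 0 →
        Nonempty (HypercubeAlgebra.R Ω ≃ₐ[ℂ]
          (HypercubeAlgebra.MatEnd (D / 4 + 1) ×
            (Fin 7 → HypercubeAlgebra.MatEnd (D / 4)) ×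
            (Fin 8 → HypercubeAlgebra.SumEnd (D / 4 - 1)))))) ∧
    Module.finrank ℂ (HypercubeAlgebra.R Ω) =
      Nat.choose (⌊(D : ℚ) / 2⌋₊ + 3) 3 + Nat.choose (⌈(D : ℚ) / 2⌉₊ + 1) 3 := by
  subst hcard
  refine ⟨⟨fun h => ?_, fun h => ?_, fun h => ?_⟩, ?_⟩
  · obtain ⟨φ⟩ := HypercubeAlgebra.nonempty_R_algEquiv_of_odd h
    exact ⟨φ.trans (HypercubeAlgebra.matProdEquiv _)⟩
  · obtain ⟨J, hJ⟩ : ∃ J, Fintype.card Ω = 4 * J + 2 := ⟨Fintype.card Ω / 4, by omega⟩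
    obtain ⟨φ⟩ := HypercubeAlgebra.nonempty_R_algEquiv_two hJ
    rw [show (Fintype.card Ω + 2) / 4 = J + 1 by omega, show (Fintype.card Ω - 2) / 4 = J by omega]
    exact ⟨φ.trans ((HypercubeAlgebra.matProdEquiv _).trans
      (HypercubeAlgebra.piIndexTwoEquiv fun t =>
        HypercubeAlgebra.MatEnd (HypercubeAlgebra.dimTwo (J + 1) J t)))⟩
  · obtain ⟨J, hJ⟩ : ∃ J, Fintype.card Ω = 4 * J := ⟨Fintype.card Ω / 4, by omega⟩
    obtain ⟨φ⟩ := HypercubeAlgebra.nonempty_R_algEquiv_zero (by omega) hJ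
    rw [show Fintype.card Ω / 4 = J by omega]
    exact ⟨φ.trans ((HypercubeAlgebra.matProdEquiv _).trans
      (HypercubeAlgebra.piIndexZeroEquiv fun t =>
        HypercubeAlgebra.MatEnd (HypercubeAlgebra.dimZero J t)))⟩
  · obtain ⟨e, he | he⟩ := Nat.even_or_odd' (Fintype.card Ω)
    · have hfloor : ⌊(Fintype.card Ω : ℚ) / 2⌋₊ = e := by
        rw [he]
        push_cast
        rw [mul_div_cancel_left₀ _ (two_ne_zero), Nat.floor_natCast]
      have hceil : ⌈(Fintype.card Ω : ℚ) / 2⌉₊ = e := by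
        rw [he]
        push_cast
        rw [mul_div_cancel_left₀ _ (two_ne_zero), Nat.ceil_natCast]
      rw [hfloor, hceil]
      obtain ⟨J, hJ | hJ⟩ := Nat.even_or_odd' e
      · obtain ⟨J, rfl⟩ : ∃ i, J = i + 1 := ⟨J - 1, by omega⟩
        obtain ⟨φ⟩ := HypercubeAlgebra.nonempty_R_algEquiv_zero (Ω := Ω) (J := J + 1) (by omega)
          (by omega)
        rw [φ.toLinearEquiv.finrank_eq, HypercubeAlgebra.finrank_matProd]
        simp only [HypercubeAlgebra.dimZero, Fintype.sum_sum_type, Fintype.sum_prod_type,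
          Sum.elim_inl, Sum.elim_inr, Finset.sum_const, Finset.card_univ, Fintype.card_fin,
          Fintype.card_unit, smul_eq_mul]
        -- Multiplied by six, the sum of squares and both binomial coefficients become polynomials,
        -- and the claim is a polynomial identity.
        have h1 := HypercubeAlgebra.six_mul_sum_sq (J + 1 - 1)
        have h2 := HypercubeAlgebra.six_mul_choose_three (e + 1)
        have h3 := HypercubeAlgebra.six_mul_choose_three (e - 1)
        rw [show e - 1 + 2 = e + 1 by omega] at h3
        rw [show e + 1 + 2 = e + 3 by omega] at h2
        rw [show e - 1 = 2 * J + 1 by omega] at h3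
        subst hJ
        simp only [Nat.add_sub_cancel] at h1 ⊢
        nlinarith
      · obtain ⟨φ⟩ := HypercubeAlgebra.nonempty_R_algEquiv_two (Ω := Ω) (J := J) (by omega)
        rw [φ.toLinearEquiv.finrank_eq, HypercubeAlgebra.finrank_matProd]
        simp only [HypercubeAlgebra.dimTwo, Fintype.sum_sum_type, Fintype.sum_prod_type,
          Sum.elim_inl, Sum.elim_inr, Finset.sum_const, Finset.card_univ, Fintype.card_fin,
          smul_eq_mul]
        have h1 := HypercubeAlgebra.six_mul_sum_sq J
        have h2 := HypercubeAlgebra.six_mul_choose_three (e + 1)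
        have h3 := HypercubeAlgebra.six_mul_choose_three (e - 1)
        rw [show e - 1 + 2 = e + 1 by omega] at h3
        rw [show e + 1 + 2 = e + 3 by omega] at h2
        rw [show e - 1 = 2 * J by omega] at h3
        subst hJ
        nlinarith
    · have hfloor : ⌊(Fintype.card Ω : ℚ) / 2⌋₊ = e := by
        rw [Nat.floor_eq_iff (by positivity), he]
        push_cast
        constructor <;> linarith
      have hceil : ⌈(Fintype.card Ω : ℚ) / 2⌉₊ = e + 1 := by
        rw [Nat.ceil_eq_iff (by omega), he]
        push_cast
        constructor <;> linarith
      rw [hfloor, hceil]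
      obtain ⟨φ⟩ := HypercubeAlgebra.nonempty_R_algEquiv_of_odd (Ω := Ω) ⟨e, he⟩
      rw [φ.toLinearEquiv.finrank_eq, HypercubeAlgebra.finrank_matProd,
        show (Fintype.card Ω + 1) / 2 = e + 1 by omega]
      have h1 := HypercubeAlgebra.six_mul_sum_sq (e + 1)
      have h2 := HypercubeAlgebra.six_mul_choose_three (e + 1)
      have h3 := HypercubeAlgebra.six_mul_choose_three e
      rw [show e + 1 + 2 = e + 3 by omega] at h2
      rw [show e + 1 + 1 = e + 2 by omega]
      nlinarith
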